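/- \textbf{Setting.} Let $\mathcal H=\bigoplus_{x\in\mathbb Z}\mathcal H_x$ be a complex Hilbert space, the Hilbert sum of cells $\mathcal H_x$ of finite nonzero dimension, and let $P$ be the projection onto $\bigoplus_{x\ge 0}\mathcal H_x$. Fix one of the ten symmetry types A, D, C, AI, AII, AIII, BDI, CI, CII, DIII. A type prescribes which of the symmetries $\eta$ (antiunitary, particle-hole), $\tau$ (antiunitary, time reversal), $\gamma$ (unitary, chiral) are present, and their squares $\pm\mathbb 1$: A: none; D: $\eta^2=1$; C: $\eta^2=-1$; AI: $\tau^2=1$; AII: $\tau^2=-1$; AIII: $\gamma^2=1$; BDI, CI, CII, DIII: all three, with $(\eta^2,\tau^2,\gamma^2)=(1,1,1),(-1,1,-1),(-1,-1,1),(1,-1,-1)$. A representation of the type consists of (anti)unitary operators with these squares which, if all three are present, commute and satisfy $\eta\tau=\gamma$. A unitary $U$ satisfies the commutation relations of a representation if $\eta U\eta^*=U$, $\tau U\tau^*=U^*$, $\gamma U\gamma^*=U^*$, for those symmetries that are present. A unitary $U$ has an essential gap at $z$ if $U-z$ is invertible modulo compact operators, and $U$ is admissible if it satisfies the commutation relations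 and has essential gaps at $+1$ and $-1$. A representation is balanced if there is a unitary $U$ on its space which satisfies the commutation relations and has neither $+1$ nor $-1$ in its spectrum. Let a representation of the type be given on $\mathcal H$ which maps each cell into itself and is balanced on each cell. Let $W$ be an admissible unitary on $\mathcal H$ which is essentially local: $P_{\ge a}-W^*P_{\ge a}W$ is compact for some $a\in\mathbb Z$, where $P_{\ge a}$ is the projection onto $\bigoplus_{x\ge a}\mathcal H_x$. Put $Q=WPW^*$ and $$\mathcal H_{ij}=\{\varphi\in\mathcal H: P\varphi=i\varphi,\ Q\varphi=j\varphi\}\ (i,j\in\{0,1\}),\qquad \mathcal H_\perp=\bigcap_{i,j}\mathcal H_{ij}^\perp .$$ Let $\tilde\eta=\eta$, $\tilde\tau=W\tau$, $\tilde\gamma=W\gamma$ (as far as present); these form a representation of the same type. Let $X=\mathbb 1-P-Q+2PQ$ and let $V_{\rm can}=(X^*X)^{-1/2}X$, where the inverse square root is taken on the orthogonal complement of the kernel of $X^*X$ and is set to zero on that kernel. \textbf{Proposition.} (1) The subspaces $\mathcal H_{00}$, $\mathcal H_{11}$, $\mathcal H_\perp$ and $\mathcal H_{01}\oplus\mathcal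 H_{10}$ are each invariant under $\tilde\eta,\tilde\tau,\tilde\gamma$. (2) For $i\ne j$ in $\{0,1\}$, $\tilde\eta\mathcal H_{ij}=\mathcal H_{ij}$, $\tilde\tau\mathcal H_{ij}=\mathcal H_{ji}$ and $\tilde\gamma\mathcal H_{ij}=\mathcal H_{ji}$, for every symmetry that is present. (3) The operator $V_{\rm can}$ restricts to a unitary operator on $\mathcal H_{00}\oplus\mathcal H_{11}\oplus\mathcal H_\perp$, which satisfies the commutation relations for the restriction of $(\tilde\eta,\tilde\tau,\tilde\gamma)$ to that subspace, has an essential gap at $-1$, and does not have the eigenvalue $-1$. (4) The representation $(\tilde\eta,\tilde\tau,\tilde\gamma)$ restricted to $\mathcal H_{01}\oplus\mathcal H_{10}$ is balanced. -/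

import Mathlib

open scoped InnerProductSpace

/-! ## Symmetry types of the tenfold way and their representations -/

/-- The ten symmetry types. -/
inductive SymType
  | A | D | C | AI | AII | AIII | BDI | CI | CII | DIII

/-- Sign of the square of the particle-hole symmetry `η`
(`none`: the symmetry is not part of the type). -/
def SymType.etaSq : SymType → Option ℤ
  | .A => none | .D => some 1 | .C => some (-1) | .AI => none | .AII => none
  | .AIII => none | .BDI => some 1 | .CI => some (-1) | .CII => some (-1) | .DIII => some 1

/-- Sign of the square of the time reversal symmetry `τ`. -/
def SymType.tauSq : SymType → Option ℤ
  | .A => none | .D => none | .C => none | .AI => some 1 | .AII => some (-1)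
  | .AIII => none | .BDI => some 1 | .CI => some 1 | .CII => some (-1) | .DIII => some (-1)

/-- Sign of the square of the chiral symmetry `γ`. -/
def SymType.gammaSq : SymType → Option ℤ
  | .A => none | .D => none | .C => none | .AI => none | .AII => none
  | .AIII => some 1 | .BDI => some 1 | .CI => some (-1) | .CII => some 1 | .DIII => some (-1)

/-- `η` is part of the type. -/
def SymType.HasEta (S : SymType) : Prop := S.etaSq.isSome = true

/-- `τ` is part of the type. -/
def SymType.HasTau (S : SymType) : Prop := S.tauSq.isSome = true

/-- `γ` is part of the type. -/
def SymType.HasGamma (S : SymType) : Prop := S.gammaSq.isSome = true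

section General

variable {E : Type*} [NormedAddCommGroup E] [InnerProductSpace ℂ E]

/-- A representation of the symmetry type `S` on `E`: antiunitary operators `η`, `τ` and a unitary
operator `γ`, as far as they are part of the type, with the squares prescribed by the type;
if all three are present they commute and `η τ = γ`. -/
structure SymRep (S : SymType) (E : Type*) [NormedAddCommGroup E] [InnerProductSpace ℂ E] where
  eta : S.HasEta → (E ≃ₗᵢ⋆[ℂ] E)
  tau : S.HasTau → (E ≃ₗᵢ⋆[ℂ] E)
  gamma : S.HasGamma → (E ≃ₗᵢ[ℂ] E)
  eta_sq : ∀ (h : S.HasEta) (φ : E), eta h (eta h φ) = S.etaSq.get h • φ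
  tau_sq : ∀ (h : S.HasTau) (φ : E), tau h (tau h φ) = S.tauSq.get h • φ
  gamma_sq : ∀ (h : S.HasGamma) (φ : E), gamma h (gamma h φ) = S.gammaSq.get h • φ
  eta_tau : ∀ (h₁ : S.HasEta) (h₂ : S.HasTau) (h₃ : S.HasGamma) (φ : E),
    eta h₁ (tau h₂ φ) = gamma h₃ φ
  eta_tau_comm : ∀ (h₁ : S.HasEta) (h₂ : S.HasTau) (φ : E),
    eta h₁ (tau h₂ φ) = tau h₂ (eta h₁ φ)
  eta_gamma_comm : ∀ (h₁ : S.HasEta) (h₃ : S.HasGamma) (φ : E),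
    eta h₁ (gamma h₃ φ) = gamma h₃ (eta h₁ φ)
  tau_gamma_comm : ∀ (h₂ : S.HasTau) (h₃ : S.HasGamma) (φ : E),
    tau h₂ (gamma h₃ φ) = gamma h₃ (tau h₂ φ)

/-- A unitary operator, seen as an element of the algebra of bounded operators. -/
noncomputable def unitaryOp (U : E ≃ₗᵢ[ℂ] E) : E →L[ℂ] E := (U.toContinuousLinearEquiv : E →L[ℂ] E)

/-- `T` has an essential gap at `z`: `z` is not in the spectrum of the image of `T` in the Calkin
algebra, i.e. `T - z` is invertible modulo compact operators. -/
def EssGapAt (T : E →L[ℂ] E) (z : ℂ) : Prop :=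
  ∃ R : E →L[ℂ] E,
    IsCompactOperator ((T - z • (1 : E →L[ℂ] E)) * R - 1 : E →L[ℂ] E) ∧
    IsCompactOperator (R * (T - z • (1 : E →L[ℂ] E)) - 1 : E →L[ℂ] E)

namespace SymRep

variable {S : SymType}

/-- The commutation relations between a unitary `U` and the symmetries (recall `σ* = σ⁻¹`):
`η U η* = U`, `τ U τ* = U*`, `γ U γ* = U*`. -/
def Satisfies (ρ : SymRep S E) (U : E ≃ₗᵢ[ℂ] E) : Prop :=
  (∀ h φ, ρ.eta h (U ((ρ.eta h).symm φ)) = U φ) ∧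
  (∀ h φ, ρ.tau h (U ((ρ.tau h).symm φ)) = U.symm φ) ∧
  (∀ h φ, ρ.gamma h (U ((ρ.gamma h).symm φ)) = U.symm φ)

/-- Admissible unitaries: the commutation relations hold, and there are essential gaps
at `+1` and `-1`. -/
def Admissible (ρ : SymRep S E) (U : E ≃ₗᵢ[ℂ] E) : Prop :=
  ρ.Satisfies U ∧ EssGapAt (unitaryOp U) 1 ∧ EssGapAt (unitaryOp U) (-1)

/-- A representation is balanced if some unitary satisfies its commutation relations and is gapped,
i.e. neither `+1` nor `-1` is in its spectrum. -/
def Balanced (ρ : SymRep S E) : Prop :=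
  ∃ U : E ≃ₗᵢ[ℂ] E, ρ.Satisfies U ∧
    (1 : ℂ) ∉ spectrum ℂ (unitaryOp U) ∧ (-1 : ℂ) ∉ spectrum ℂ (unitaryOp U)

/-- A subspace is invariant under all symmetries of the representation. -/
def Invariant (ρ : SymRep S E) (K : Submodule ℂ E) : Prop :=
  (∀ h, ∀ φ ∈ K, ρ.eta h φ ∈ K) ∧ (∀ h, ∀ φ ∈ K, ρ.tau h φ ∈ K) ∧
  (∀ h, ∀ φ ∈ K, ρ.gamma h φ ∈ K)

end SymRep

theorem SymType.etaSq_mul_self (S : SymType) (h : S.HasEta) :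
    S.etaSq.get h * S.etaSq.get h = 1 := by
  cases S <;> first | rfl | exact absurd h (by simp [SymType.HasEta, SymType.etaSq])

theorem SymType.tauSq_mul_self (S : SymType) (h : S.HasTau) :
    S.tauSq.get h * S.tauSq.get h = 1 := by
  cases S <;> first | rfl | exact absurd h (by simp [SymType.HasTau, SymType.tauSq])

theorem SymType.gammaSq_mul_self (S : SymType) (h : S.HasGamma) :
    S.gammaSq.get h * S.gammaSq.get h = 1 := by
  cases S <;> first | rfl | exact absurd h (by simp [SymType.HasGamma, SymType.gammaSq])

section Restrict

variable {σ : ℂ →+* ℂ} [RingHomInvPair σ σ]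

theorem map_eq_of_sq (e : E ≃ₛₗᵢ[σ] E) (K : Submodule ℂ E) (hK : ∀ φ ∈ K, e φ ∈ K)
    (c : ℤ) (hc : c * c = 1) (he : ∀ φ, e (e φ) = c • φ) :
    K.map (e.toLinearEquiv : E →ₛₗ[σ] E) = K := by
  apply le_antisymm
  · rintro _ ⟨φ, hφ, rfl⟩
    exact hK φ hφ
  · intro φ hφ
    refine ⟨c • e φ, K.smul_of_tower_mem c (hK φ hφ), ?_⟩
    change e (c • e φ) = φ
    rw [map_zsmul, he, smul_smul, hc, one_smul]

/-- Restriction of a unitary or antiunitary operator to a subspace that it maps onto itself. -/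
noncomputable def restrictIsometry (e : E ≃ₛₗᵢ[σ] E) (K : Submodule ℂ E)
    (h : K.map (e.toLinearEquiv : E →ₛₗ[σ] E) = K) : K ≃ₛₗᵢ[σ] K where
  toLinearEquiv := e.toLinearEquiv.ofSubmodules K K h
  norm_map' φ := e.norm_map φ

end Restrict

/-- Restriction of a representation to an invariant subspace. -/
noncomputable def SymRep.restrict {S : SymType} (ρ : SymRep S E) (K : Submodule ℂ E)
    (hK : ρ.Invariant K) : SymRep S K where
  eta h := restrictIsometry (ρ.eta h) K
    (map_eq_of_sq _ K (hK.1 h) _ (S.etaSq_mul_self h) (ρ.eta_sq h))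
  tau h := restrictIsometry (ρ.tau h) K
    (map_eq_of_sq _ K (hK.2.1 h) _ (S.tauSq_mul_self h) (ρ.tau_sq h))
  gamma h := restrictIsometry (ρ.gamma h) K
    (map_eq_of_sq _ K (hK.2.2 h) _ (S.gammaSq_mul_self h) (ρ.gamma_sq h))
  eta_sq h φ := Subtype.ext (ρ.eta_sq h φ)
  tau_sq h φ := Subtype.ext (ρ.tau_sq h φ)
  gamma_sq h φ := Subtype.ext (ρ.gamma_sq h φ)
  eta_tau h₁ h₂ h₃ φ := Subtype.ext (ρ.eta_tau h₁ h₂ h₃ φ)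
  eta_tau_comm h₁ h₂ φ := Subtype.ext (ρ.eta_tau_comm h₁ h₂ φ)
  eta_gamma_comm h₁ h₃ φ := Subtype.ext (ρ.eta_gamma_comm h₁ h₃ φ)
  tau_gamma_comm h₂ h₃ φ := Subtype.ext (ρ.tau_gamma_comm h₂ h₃ φ)

namespace SymRep

variable {S : SymType} {ρ : SymRep S E} {U : E ≃ₗᵢ[ℂ] E}

theorem Satisfies.eta_comm (hU : ρ.Satisfies U) (h : S.HasEta) (φ : E) :
    ρ.eta h (U φ) = U (ρ.eta h φ) := by
  simpa using hU.1 h (ρ.eta h φ)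

theorem Satisfies.tau_comm (hU : ρ.Satisfies U) (h : S.HasTau) (φ : E) :
    U (ρ.tau h (U φ)) = ρ.tau h φ := by
  have := congrArg U (hU.2.1 h (ρ.tau h φ))
  simpa using this

theorem Satisfies.gamma_comm (hU : ρ.Satisfies U) (h : S.HasGamma) (φ : E) :
    U (ρ.gamma h (U φ)) = ρ.gamma h φ := by
  have := congrArg U (hU.2.2 h (ρ.gamma h φ))
  simpa using this

/-- The twisted representation `(η, Wτ, Wγ)` of the same type. -/
noncomputable def twist (ρ : SymRep S E) (W : E ≃ₗᵢ[ℂ] E) (hW : ρ.Satisfies W) : SymRep S E where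
  eta h := ρ.eta h
  tau h := (ρ.tau h).trans W
  gamma h := (ρ.gamma h).trans W
  eta_sq h φ := ρ.eta_sq h φ
  tau_sq h φ := by simp [hW.tau_comm, ρ.tau_sq]
  gamma_sq h φ := by simp [hW.gamma_comm, ρ.gamma_sq]
  eta_tau h₁ h₂ h₃ φ := by simp [hW.eta_comm, ρ.eta_tau h₁ h₂ h₃]
  eta_tau_comm h₁ h₂ φ := by simp [hW.eta_comm, ρ.eta_tau_comm]
  eta_gamma_comm h₁ h₃ φ := by simp [hW.eta_comm, ρ.eta_gamma_comm]
  tau_gamma_comm h₂ h₃ φ := by simp [hW.tau_comm, hW.gamma_comm, ρ.tau_gamma_comm]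

end SymRep

end General

/-! ## Cells, half-space projections, pairs of projections -/

section Hilbert

variable {H : Type*} [NormedAddCommGroup H] [InnerProductSpace ℂ H]

/-- `H` is the Hilbert space direct sum of the cells `cell x`, `x ∈ ℤ`, each of which is
of finite nonzero dimension. -/
structure IsCellStructure (cell : ℤ → Submodule ℂ H) : Prop where
  finiteDimensional : ∀ x, FiniteDimensional ℂ (cell x)
  ne_bot : ∀ x, cell x ≠ ⊥
  orthogonal : ∀ x y, x ≠ y → ∀ φ ∈ cell x, ∀ ψ ∈ cell y, ⟪φ, ψ⟫_ℂ = 0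
  dense : (⨆ x, cell x).topologicalClosure = ⊤

/-- The common eigenspace `H_ij` of two projections `P`, `Q`, where `P = i` and `Q = j`. -/
noncomputable def jointSpace (P Q : H →L[ℂ] H) (i j : Fin 2) : Submodule ℂ H where
  carrier := {φ | P φ = (i.val : ℂ) • φ ∧ Q φ = (j.val : ℂ) • φ}
  add_mem' := by
    rintro a b ⟨h1, h2⟩ ⟨h3, h4⟩
    exact ⟨by rw [map_add, h1, h3, smul_add], by rw [map_add, h2, h4, smul_add]⟩
  zero_mem' := by simp
  smul_mem' := by
    rintro c a ⟨h1, h2⟩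
    exact ⟨by rw [map_smul, h1, smul_comm], by rw [map_smul, h2, smul_comm]⟩

/-- `H_⊥`, the intersection of the orthogonal complements of the four spaces `H_ij`. -/
noncomputable def perpSpace (P Q : H →L[ℂ] H) : Submodule ℂ H := ⨅ i, ⨅ j, (jointSpace P Q i j)ᗮ

variable [CompleteSpace H]

/-- The projection onto the half space `⨁_{x ≥ a} H_x`. -/
noncomputable def halfProj (cell : ℤ → Submodule ℂ H) (a : ℤ) : H →L[ℂ] H :=
  (⨆ x : ℤ, ⨆ _ : a ≤ x, cell x).topologicalClosure.starProjection

/-- `W` is essentially local: `P_{≥a} - W* P_{≥a} W` is compact for some `a`. -/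
def EssLocal (cell : ℤ → Submodule ℂ H) (W : H ≃ₗᵢ[ℂ] H) : Prop :=
  ∃ a : ℤ, IsCompactOperator
    (halfProj cell a - unitaryOp W.symm * halfProj cell a * unitaryOp W : H →L[ℂ] H)

/-- `X = 1 - P - Q + 2PQ`. -/
noncomputable def opX (P Q : H →L[ℂ] H) : H →L[ℂ] H := 1 - P - Q + (2 : ℂ) • (P * Q)

/-- The canonical decoupling operator `V_can = (X* X)^{-1/2} X`, the inverse square root being
taken by the functional calculus on the complement of the kernel
(it is set to zero on the kernel, since `(√0)⁻¹ = 0`). -/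
noncomputable def vCan (P Q : H →L[ℂ] H) : H →L[ℂ] H :=
  cfc (fun t : ℝ => (Real.sqrt t)⁻¹) (star (opX P Q) * opX P Q) * opX P Q

end Hilbert

/-! Essential locality makes `P - Q` compact: moving the cut between `a` and `0` changes the
half-space projection only by finitely many finite-dimensional cells. The original symmetries
commute with `P`, so the twisted `η` commutes with `P` and `Q`, while the twisted `τ` and `γ`
exchange them, e.g. `WτP = WPτ = Q(Wτ)`. This gives (1) and (2).

For (3), `X = PQ + (1-P)(1-Q)` is normal, `D = X*X = 1 - (P-Q)²` and `X + X* = 2D`. Its kernel is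
`H_01 ⊕ H_10`, so the space in (3) is the orthogonal complement of that kernel. Since `1 - D` is
compact, the spectrum of `D` has a gap above `0` and the inverse square root is continuous on it
(`exists_vCan_factor`). Exchanging `P` and `Q` turns `X` into `X*` and fixes `D`, which is the
source of the commutation relations; `V + V* = 2√D ≥ 0` keeps `V` away from `-1`
(`exists_decoupling`).

For (4), `H_01` and `H_10` are finite dimensional, and one constructs an isometry `U` with `U² = -1`
and the right commutation relations; its spectrum lies in `{i, -i}`. The grading that is `+1` on
`H_01` and `-1` on `H_10` anticommutes with `γ`, and `γ` times the grading, or `i` times it,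
suffices in several types. The others need a complex structure commuting with `η`; it exists if `η²
= -1`, or if `η² = 1` and the dimension is even (`exists_skew_complexStructure`). The obstruction is
thus a parity: that of `dim H_01 + dim H_10` in type D, and that of `dim H_01` in type DIII.

These parities are even because of the gaps of `W` at `±1`. The spaces `H_01` and `H_10` correspond
to the kernels of the compression `T_0 = PWP + (1-P)` and of its adjoint. Deform `W` to `W - tW*`:
for `t < 1` this is invertible, and at `t = 1` it is invertible modulo compacts since `W(W - W*) =
(W+1)(W-1)`. Essential locality passes this on to the compressions `T_t`. In DIII the operators
`γT_t` are real and skew-adjoint; in D one doubles the space and uses `(x, y) ↦ (T_t y, -T_t* x)`.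
The parity of the kernel of such a family is constant (`even_finrank_ker_path`), and at `t = 1`
symmetry between `W` and `W*` forces it to be even. -/

/-! ### Alternating forms and parity of dimension. -/

section Parity

/-- A nondegenerate alternating form lives on an even dimensional space. -/
theorem even_finrank_of_nondegenerate {V : Type*} [AddCommGroup V] [Module ℂ V]
    [FiniteDimensional ℂ V] (B : LinearMap.BilinForm ℂ V) (hB : ∀ x, B x x = 0)
    (hnd : ∀ x, (∀ y, B y x = 0) → x = 0) : Even (Module.finrank ℂ V) := by
  classical
  let b := Module.finBasis ℂ V
  let M := LinearMap.BilinForm.toMatrix b B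
  have hM : M.transpose = -M := by
    ext i j
    have h := hB (b i + b j)
    simp only [map_add, LinearMap.add_apply, hB, zero_add, add_zero] at h
    simp only [Matrix.transpose_apply, Matrix.neg_apply, M, LinearMap.BilinForm.toMatrix_apply]
    linear_combination h
  -- In odd size a skew matrix has `det M = det (-M) = -det M`, so a nonzero determinant rules out
  -- odd dimension.
  have hdet : M.det ≠ 0 := by
    intro h0
    obtain ⟨v, hv, hMv⟩ := Matrix.exists_mulVec_eq_zero_iff.mpr h0
    apply hv
    have hx : b.equivFun.symm v = 0 := by
      apply hnd
      intro y
      have key : ∀ i, B (b i) (b.equivFun.symm v) = 0 := by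
        intro i
        have := congrFun hMv i
        simp only [Matrix.mulVec, dotProduct, M, LinearMap.BilinForm.toMatrix_apply,
          Pi.zero_apply] at this
        rw [Module.Basis.equivFun_symm_apply, map_sum, ← this]
        refine Finset.sum_congr rfl fun j _ => ?_
        rw [map_smul, smul_eq_mul, mul_comm]
      have : B.flip (b.equivFun.symm v) = 0 := b.ext fun i => by simpa using key i
      exact LinearMap.congr_fun this y
    exact (LinearEquiv.map_eq_zero_iff _).mp hx
  by_contra hodd
  rw [Nat.not_even_iff_odd] at hodd
  have h := congrArg Matrix.det hM
  rw [Matrix.det_transpose, Matrix.det_neg, Fintype.card_fin, hodd.neg_one_pow] at h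
  apply hdet
  linear_combination h / 2

/-- The rank of an alternating form is even. -/
theorem even_finrank_add_finrank_ker {V : Type*} [AddCommGroup V] [Module ℂ V]
    [FiniteDimensional ℂ V] (B : LinearMap.BilinForm ℂ V) (hB : ∀ x, B x x = 0) :
    Even (Module.finrank ℂ V + Module.finrank ℂ (LinearMap.ker B)) := by
  obtain ⟨C, hC⟩ := Submodule.exists_isCompl (LinearMap.ker B)
  have hskew : ∀ x y, B x y = -B y x := by
    intro x y
    have h := hB (x + y)
    simp only [map_add, LinearMap.add_apply, hB, zero_add, add_zero] at h
    linear_combination h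
  have hev : Even (Module.finrank ℂ C) := by
    apply even_finrank_of_nondegenerate (B.domRestrict₁₂ C C) (fun x => hB x)
    intro x hx
    have hx' : (x : V) ∈ LinearMap.ker B := by
      rw [LinearMap.mem_ker]
      ext y
      have hy : y ∈ LinearMap.ker B ⊔ C := by rw [hC.sup_eq_top]; trivial
      obtain ⟨k, hk, c, hc, rfl⟩ := Submodule.mem_sup.mp hy
      rw [map_add, hskew, LinearMap.mem_ker.mp hk, hskew _ c]
      have := hx ⟨c, hc⟩
      simp only [LinearMap.domRestrict₁₂_apply] at this
      simp [this]
    have := Submodule.disjoint_def.mp hC.disjoint _ hx' x.2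
    exact Subtype.ext this
  rw [← Submodule.finrank_add_eq_of_isCompl hC]
  obtain ⟨k, hk⟩ := hev
  exact ⟨Module.finrank ℂ (LinearMap.ker B) + k, by omega⟩

end Parity

/-! ### Operators that are left invertible modulo compact operators. -/

section LeftParametrix

variable {E : Type*} [NormedAddCommGroup E] [InnerProductSpace ℂ E]

/-- On the kernel, `-(RT - 1)` is the identity; a compact identity forces finite dimension (Riesz).
-/
theorem finiteDimensional_ker_of_leftParametrix {T R : E →L[ℂ] E}
    (hR : IsCompactOperator (R * T - 1 : E →L[ℂ] E)) : FiniteDimensional ℂ T.ker := by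
  have hK := hR.comp_clm T.ker.subtypeL
  have hval : ∀ x : T.ker, -((R * T - 1 : E →L[ℂ] E) (x : E)) = x := fun x => by
    have hx : T (x : E) = 0 := x.2
    simp [hx]
  have h2 := IsCompactOperator.codRestrict (V := T.ker)
    (f := fun x : T.ker => -((R * T - 1 : E →L[ℂ] E) (x : E))) hK.neg
    (fun x => by rw [hval]; exact x.2) T.isClosed_ker
  apply FiniteDimensional.of_isCompactOperator_id (𝕜 := ℂ)
  convert! h2 using 1
  ext x
  exact (hval x).symm

/-- Otherwise there are unit vectors with `T xₙ → 0`. Writing `xₙ = R T xₙ - (RT - 1) xₙ`,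
compactness gives a subsequence converging to a unit vector in the kernel. -/
theorem antilipschitz_of_leftParametrix {T R : E →L[ℂ] E}
    (hR : IsCompactOperator (R * T - 1 : E →L[ℂ] E)) (hT : ∀ x, T x = 0 → x = 0) :
    ∃ c, AntilipschitzWith c T := by
  by_contra hcon
  have hseq : ∀ n : ℕ, ∃ x : E, ‖x‖ = 1 ∧ ‖T x‖ ≤ 1 / ((n : ℝ) + 1) := by
    intro n
    by_contra hn
    push Not at hn
    apply hcon
    refine ⟨(n : NNReal) + 1, T.antilipschitz_of_bound fun x => ?_⟩
    by_cases hx : x = 0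
    · simp [hx]
    have hx0 : 0 < ‖x‖ := norm_pos_iff.mpr hx
    have h1 := hn (((‖x‖⁻¹ : ℝ) : ℂ) • x) (by
      rw [norm_smul, Complex.norm_real, norm_inv, norm_norm, inv_mul_cancel₀ hx0.ne'])
    rw [map_smul, norm_smul, Complex.norm_real, norm_inv, norm_norm, inv_mul_eq_div,
      div_lt_div_iff₀ (by positivity) hx0] at h1
    push_cast
    nlinarith
  choose x hx1 hxT using hseq
  obtain ⟨K, hKc, hK⟩ := hR.image_closedBall_subset_compact (f := (R * T - 1 : E →L[ℂ] E).toLinearMap) 1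
  have hmem : ∀ n, (R * T - 1 : E →L[ℂ] E) (x n) ∈ K := fun n =>
    hK ⟨x n, by simp [hx1 n], rfl⟩
  obtain ⟨y, -, φ, hφ, hy⟩ := hKc.tendsto_subseq hmem
  have hT0 : Filter.Tendsto (fun n => T (x n)) Filter.atTop (nhds 0) :=
    squeeze_zero_norm hxT tendsto_one_div_add_atTop_nhds_zero_nat
  have hT0φ := hT0.comp hφ.tendsto_atTop
  have hlim : Filter.Tendsto (fun n => x (φ n)) Filter.atTop (nhds (-y)) := by
    have h := ((R.continuous.tendsto 0).comp hT0φ).sub hy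
    rw [map_zero, zero_sub] at h
    refine h.congr fun n => ?_
    simp
  have hTy : T (-y) = 0 :=
    tendsto_nhds_unique ((T.continuous.tendsto _).comp hlim) hT0φ
  have hy0 := hT _ hTy
  have hn : ‖-y‖ = 1 := by
    refine tendsto_nhds_unique hlim.norm ?_
    simp [hx1]
  rw [hy0, norm_zero] at hn
  exact zero_ne_one hn

theorem isCompactOperator_starProjection (N : Submodule ℂ E) [FiniteDimensional ℂ N] :
    IsCompactOperator N.starProjection := by
  have : IsCompactOperator N.subtypeL :=
    have : ProperSpace N := FiniteDimensional.proper ℂ _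
    isCompactOperator_of_locallyCompactSpace_rng N.subtypeL
  exact this.comp_clm N.orthogonalProjectionOnto

variable [CompleteSpace E]

/-- The lower bound for `T` makes the range closed, and injectivity of the adjoint makes it dense.
-/
theorem isUnit_of_leftParametrix {T R : E →L[ℂ] E}
    (hR : IsCompactOperator (R * T - 1 : E →L[ℂ] E)) (hT : ∀ x, T x = 0 → x = 0)
    (hT' : ∀ x, star T x = 0 → x = 0) : IsUnit T := by
  rw [ContinuousLinearMap.isUnit_iff_bijective,
    ContinuousLinearMap.bijective_iff_dense_range_and_antilipschitz]
  refine ⟨?_, antilipschitz_of_leftParametrix hR hT⟩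
  rw [Submodule.topologicalClosure_eq_top_iff, Submodule.eq_bot_iff]
  intro x hx
  apply hT'
  rw [ContinuousLinearMap.star_eq_adjoint]
  rw [ContinuousLinearMap.orthogonal_range] at hx
  exact hx

/-- A self-adjoint or skew-adjoint operator which is invertible modulo compact operators becomes
invertible when the projection onto its kernel is added. -/
theorem isUnit_add_starProjection_ker {T R : E →L[ℂ] E}
    (hR : IsCompactOperator (R * T - 1 : E →L[ℂ] E)) [FiniteDimensional ℂ T.ker]
    (hT : star T = T ∨ star T = -T) :
    T * T.ker.starProjection = 0 ∧ T.ker.starProjection * T = 0 ∧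
      IsUnit (T + T.ker.starProjection) := by
  set p := T.ker.starProjection with hp
  have hTp : T * p = 0 := by
    ext x
    exact (Submodule.starProjection_apply_mem T.ker x : _)
  have hpsa : star p = p := isSelfAdjoint_starProjection T.ker
  have hpT : p * T = 0 := by
    have h := congrArg star hTp
    rw [star_mul, hpsa, star_zero] at h
    rcases hT with hT | hT
    · rwa [hT] at h
    · rwa [hT, mul_neg, neg_eq_zero] at h
  have hpp : p * p = p := T.ker.isIdempotentElem_starProjection
  have hinj : ∀ s : ℂ, s ≠ 0 → ∀ x, (s • T + p) x = 0 → x = 0 := by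
    intro s hs x hx
    have h1 := congrArg p hx
    have h2 : p (T x) = 0 := congrArg (fun z : E →L[ℂ] E => z x) hpT
    have h3 : p (p x) = p x := congrArg (fun z : E →L[ℂ] E => z x) hpp
    simp only [add_apply, map_add, smul_apply, map_smul, h2, h3, smul_zero, zero_add,
      map_zero] at h1 hx
    rw [h1, add_zero] at hx
    have : x ∈ T.ker := (smul_eq_zero.mp hx).resolve_left hs
    rw [← Submodule.starProjection_eq_self_iff.mpr this]
    exact h1
  refine ⟨hTp, hpT, isUnit_of_leftParametrix (R := R) ?_ ?_ ?_⟩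
  · have : (R * (T + p) - 1 : E →L[ℂ] E) = (R * T - 1) + R * p := by noncomm_ring
    rw [this]
    exact hR.add ((isCompactOperator_starProjection T.ker).clm_comp R)
  · simpa using hinj 1 one_ne_zero
  · rw [star_add, hpsa]
    rcases hT with hT | hT
    · rw [hT]
      simpa using hinj 1 one_ne_zero
    · rw [hT]
      simpa using hinj (-1) (by norm_num)

end LeftParametrix

/-! ### Stability of the kernel parity for real skew-adjoint operators. -/

section Parity

variable {E : Type*} [NormedAddCommGroup E] [InnerProductSpace ℂ E]

/-- A conjugation: an antiunitary involution. -/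
structure IsConjugation (η : E →ₗ⋆[ℂ] E) : Prop where
  apply_apply : ∀ x, η (η x) = x
  inner_comm : ∀ x y, ⟪η x, y⟫_ℂ = ⟪η y, x⟫_ℂ

variable [CompleteSpace E]

/-- A skew-adjoint operator which is real for a conjugation `η` makes `⟪η x, T y⟫` alternating. -/
theorem IsConjugation.inner_self_of_skew {η : E →ₗ⋆[ℂ] E} (hη : IsConjugation η) {T : E →L[ℂ] E}
    (hT : star T = -T) (hTη : ∀ x, T (η x) = η (T x)) (x : E) : ⟪η x, T x⟫_ℂ = 0 := by
  have h1 : ⟪η x, T x⟫_ℂ = ⟪η (T x), x⟫_ℂ := hη.inner_comm _ _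
  rw [← hTη, ← ContinuousLinearMap.adjoint_inner_right, ← ContinuousLinearMap.star_eq_adjoint, hT,
    neg_apply, inner_neg_right] at h1
  linear_combination h1 / 2

/-- Lyapunov-Schmidt reduction: the kernels of two real skew-adjoint operators have the same parity
if the second one is invertible off the kernel of the first one. -/
theorem even_finrank_ker_add_of_isUnit {η : E →ₗ⋆[ℂ] E} (hη : IsConjugation η)
    {T : E →L[ℂ] E} (hT : star T = -T) (hTη : ∀ x, T (η x) = η (T x))
    (N : Submodule ℂ E) [FiniteDimensional ℂ N] (hN : ∀ x ∈ N, η x ∈ N)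
    (hG : IsUnit ((1 - N.starProjection) * T * (1 - N.starProjection) + N.starProjection)) :
    Even (Module.finrank ℂ N + Module.finrank ℂ T.ker) := by
  set p := N.starProjection with hp
  obtain ⟨u, hu⟩ := hG
  have hpp : p * p = p := N.isIdempotentElem_starProjection
  have hpG : p * (u : E →L[ℂ] E) = p := by
    have h : p * (1 - p) = 0 := by rw [mul_sub, mul_one, hpp, sub_self]
    rw [hu, mul_add, hpp, ← mul_assoc, ← mul_assoc, h, zero_mul, zero_mul, zero_add]
  have hGp : ∀ x, p x = 0 → (u : E →L[ℂ] E) x = T x - p (T x) := by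
    intro x hx
    rw [hu]
    simp [hx]
  have huinj : Function.Injective (u : E →L[ℂ] E) := by
    intro x y hxy
    have h := congrArg (u⁻¹ : (E →L[ℂ] E)ˣ).val hxy
    rwa [← mul_apply_eq_comp, ← mul_apply_eq_comp, Units.inv_mul] at h
  -- `c n ∈ Nᗮ` solves `(1 - p) T (n + c n) = 0`, so `L n = n + c n` satisfies `T (L n) ∈ N`. Every
  -- kernel vector `x` is `L (p x)`.
  let c : E →L[ℂ] E := -((u⁻¹ : (E →L[ℂ] E)ˣ) * ((1 - p) * T))
  have huc : ∀ x, (u : E →L[ℂ] E) (c x) = -(T x - p (T x)) := by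
    intro x
    have : (u : E →L[ℂ] E) * c = -((1 - p) * T) := by
      simp only [c, mul_neg, Units.mul_inv_cancel_left]
    rw [← mul_apply_eq_comp, this]
    simp
  have hppx : ∀ x, p (p x) = p x := fun x => by rw [← mul_apply_eq_comp, hpp]
  have hpc : ∀ x, p (c x) = 0 := by
    intro x
    have := congrArg (fun z : E →L[ℂ] E => z (c x)) hpG
    simp only [mul_apply_eq_comp] at this
    rw [← this, huc, map_neg, map_sub, hppx, sub_self, neg_zero]
  let L : N →ₗ[ℂ] E := N.subtype + c.toLinearMap ∘ₗ N.subtype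
  have hL : ∀ n : N, L n = n + c n := fun n => rfl
  have hpmem : ∀ x, p x = x ↔ x ∈ N := fun x => Submodule.starProjection_eq_self_iff
  have hTL : ∀ n, T (L n) ∈ N := by
    intro n
    rw [← hpmem]
    have h1 := huc n
    rw [hGp _ (hpc _)] at h1
    rw [hL, map_add, map_add]
    rw [← sub_eq_zero] at h1 ⊢
    rw [← neg_eq_zero, ← h1]
    abel
  have horth : ∀ x, ∀ y ∈ N, ⟪y, c x⟫_ℂ = 0 := by
    intro x y hy
    exact (Submodule.mem_orthogonal _ _).mp (N.starProjection_apply_eq_zero_iff.mp (hpc x))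
      y hy
  -- This is the Schur complement on `N`, as a form. The antilinearity of `η` cancels that of the
  -- first slot, so `B` is bilinear. It is alternating because replacing `η n` by `η (L n)` changes
  -- nothing: `c n` is orthogonal to `N`.
  let B : LinearMap.BilinForm ℂ N := LinearMap.mk₂ ℂ (fun m n => ⟪η n, T (L m)⟫_ℂ)
    (fun a b d => by simp) (fun a b d => by simp)
    (fun a b d => by simp) (fun a b d => by simp [mul_comm])
  have hBa : ∀ m n, B m n = ⟪η n, T (L m)⟫_ℂ := fun m n => rfl
  have hB : ∀ n, B n n = 0 := by
    intro n
    have h1 := hη.inner_self_of_skew hT hTη (L n)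
    rw [hL, map_add, inner_add_left, ← hL, hη.inner_comm (c n), horth _ _ (hN _ (hTL n)),
      add_zero] at h1
    exact h1
  have hLinj : Function.Injective L := by
    rw [← LinearMap.ker_eq_bot, Submodule.eq_bot_iff]
    intro n hn
    have h := congrArg p (LinearMap.mem_ker.mp hn)
    rw [hL, map_add, hpc, add_zero, map_zero, (hpmem _).mpr n.2] at h
    exact Subtype.ext h
  have hker : T.ker = (LinearMap.ker B).map L := by
    ext x
    constructor
    · intro hx
      have hx : T x = 0 := hx
      have hxn : p x ∈ N := Submodule.starProjection_apply_mem _ _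
      have hLx : L ⟨p x, hxn⟩ = x := by
        rw [hL]
        have : c (p x) = x - p x := by
          apply huinj
          rw [huc, hGp _ (by rw [map_sub, hppx, sub_self])]
          simp only [map_sub, hx, map_zero]
          abel
        simp [this]
      refine ⟨⟨p x, hxn⟩, ?_, hLx⟩
      refine LinearMap.mem_ker.mpr (LinearMap.ext fun n => ?_)
      rw [hBa, hLx, hx, inner_zero_right, LinearMap.zero_apply]
    · rintro ⟨n, hn, rfl⟩
      have h := LinearMap.congr_fun (LinearMap.mem_ker.mp hn) ⟨η (T (L n)), hN _ (hTL n)⟩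
      rw [hBa, hη.apply_apply, LinearMap.zero_apply, inner_self_eq_zero] at h
      exact h
  rw [hker, ← (Submodule.equivMapOfInjective L hLinj _).finrank_eq]
  exact even_finrank_add_finrank_ker B hB

/-- The parity of the dimension of the kernel is constant along a continuous path of real
skew-adjoint operators which are invertible modulo compact operators. -/
theorem even_finrank_ker_path {η : E →ₗ⋆[ℂ] E} (hη : IsConjugation η)
    (T : unitInterval → E →L[ℂ] E) (hTc : Continuous T) (hT : ∀ t, star (T t) = -T t)
    (hTη : ∀ t x, T t (η x) = η (T t x))
    (hR : ∀ t, ∃ R : E →L[ℂ] E, IsCompactOperator (R * T t - 1 : E →L[ℂ] E)) :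
    Even (Module.finrank ℂ (T 0).ker + Module.finrank ℂ (T 1).ker) := by
  let f : unitInterval → ℕ := fun t => Module.finrank ℂ (T t).ker % 2
  have hf : IsLocallyConstant f := by
    rw [IsLocallyConstant.iff_eventually_eq]
    intro t
    obtain ⟨R, hRt⟩ := hR t
    have hfd : FiniteDimensional ℂ (T t).ker := finiteDimensional_ker_of_leftParametrix hRt
    obtain ⟨hTp, hpT, hunit⟩ := isUnit_add_starProjection_ker hRt (Or.inr (hT t))
    set p := (T t).ker.starProjection with hp
    -- At the base point the compressed block is `T t + p`, which is invertible; openness of the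
    -- units carries this to nearby parameters.
    have hG0 : (1 - p) * T t * (1 - p) + p = T t + p := by
      simp only [sub_mul, one_mul, hpT, sub_zero, mul_sub, mul_one, hTp]
    have hev : ∀ᶠ s in nhds t, IsUnit ((1 - p) * T s * (1 - p) + p) := by
      have hc : Continuous fun s => (1 - p) * T s * (1 - p) + p := by fun_prop
      refine hc.continuousAt.eventually (Units.isOpen.mem_nhds ?_)
      change IsUnit _
      beta_reduce
      rw [hG0]
      exact hunit
    filter_upwards [hev] with s hs
    have := even_finrank_ker_add_of_isUnit hη (hT s) (hTη s) (T t).ker (fun x hx => by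
      have hx : T t x = 0 := hx
      change T t (η x) = 0
      rw [hTη, hx, map_zero]) hs
    simp only [f]
    rw [Nat.even_iff] at this
    omega
  have h01 := hf.apply_eq_of_isPreconnected isPreconnected_univ (Set.mem_univ 0) (Set.mem_univ 1)
  rw [Nat.even_iff]
  simp only [f] at h01
  omega

end Parity

/-! ### Half-space compressions of the path from `w` to `w - w*`. -/

section Compression

variable {E : Type*} [NormedAddCommGroup E] [InnerProductSpace ℂ E]

/-- If the off-diagonal block `(1 - p) S p` is compact, a parametrix of `S` compresses to a
parametrix of the corner `p S p`. -/
theorem leftParametrix_compression {p S R : E →L[ℂ] E} (hp : p * p = p)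
    (hR : IsCompactOperator (R * S - 1 : E →L[ℂ] E))
    (hS : IsCompactOperator ((1 - p) * S * p : E →L[ℂ] E)) :
    IsCompactOperator ((p * R * p + (1 - p)) * (p * S * p + (1 - p)) - 1 : E →L[ℂ] E) := by
  have h : (p * R * p + (1 - p)) * (p * S * p + (1 - p)) - 1
      = p * (R * S - 1) * p - p * R * ((1 - p) * S * p) := by
    have h1 : ∀ x, p (p x) = p x := fun x => by rw [← mul_apply_eq_comp, hp]
    ext x
    simp only [mul_apply_eq_comp, add_apply, sub_apply, one_apply_eq_self, map_add, map_sub, h1]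
    abel
  rw [h]
  exact ((hR.comp_clm p).clm_comp p).sub (hS.clm_comp (p * R))

variable [CompleteSpace E]

/-- For `z² = 1` one has `w* - z = -z w* (w - z)`, a unitary multiple of `w - z`. -/
theorem EssGapAt.star_of_unitary {w : E →L[ℂ] E} (hw : star w * w = 1) (hw' : w * star w = 1)
    {z : ℂ} (hz : z * z = 1) (h : EssGapAt w z) : EssGapAt (star w) z := by
  obtain ⟨R, h1, h2⟩ := h
  have e : star w - z • (1 : E →L[ℂ] E) = -(z • (star w * (w - z • 1))) := by
    rw [mul_sub, hw, mul_smul_comm, mul_one, smul_sub, smul_smul, hz, one_smul, neg_sub]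
  refine ⟨-(z • (R * w)), ?_, ?_⟩
  · have : (star w - z • (1 : E →L[ℂ] E)) * -(z • (R * w)) - 1
        = star w * ((w - z • 1) * R - 1) * w := by
      rw [e, neg_mul_neg, smul_mul_assoc, mul_smul_comm, smul_smul, hz, one_smul,
        mul_sub (star w) (_ * R), mul_one, sub_mul _ _ w, hw]
      simp only [mul_assoc]
    rw [this]
    exact (h1.comp_clm w).clm_comp (star w)
  · have : -(z • (R * w)) * (star w - z • (1 : E →L[ℂ] E)) - 1 = R * (w - z • 1) - 1 := by
      rw [e]
      simp only [neg_mul_neg, smul_mul_assoc, mul_smul_comm, smul_smul, hz, one_smul]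
      rw [mul_assoc R, ← mul_assoc w, hw', one_mul]
    rw [this]
    exact h2

/-- With essential gaps at `±1`, the path from `w` to `w - w*` stays invertible modulo compact
operators. -/
theorem leftParametrix_sub_smul_star {w : E →L[ℂ] E} (hw : star w * w = 1) (hw' : w * star w = 1)
    (h1 : EssGapAt w 1) (h2 : EssGapAt w (-1)) (t : unitInterval) :
    ∃ R : E →L[ℂ] E, IsCompactOperator (R * (w - ((t : ℝ) : ℂ) • star w) - 1 : E →L[ℂ] E) := by
  rcases eq_or_ne t 1 with rfl | ht
  · obtain ⟨R, -, hR⟩ := h1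
    obtain ⟨R', -, hR'⟩ := h2
    -- Multiplication by `w` gives `w(w - w*) = w² - 1 = (w + 1)(w - 1)`; then the parametrices at
    -- `-1` and `+1` are applied in turn.
    refine ⟨R * R' * w, ?_⟩
    have hR1 : R * R' * w * (w - (((1 : unitInterval) : ℝ) : ℂ) • star w) - 1
        = R * (R' * (w - (-1 : ℂ) • 1) - 1) * (w - (1 : ℂ) • 1) + (R * (w - (1 : ℂ) • 1) - 1) := by
      have : (w - (-1 : ℂ) • 1) * (w - (1 : ℂ) • 1) = w * w - 1 := by
        rw [neg_one_smul, one_smul]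
        noncomm_ring
      simp only [Set.Icc.coe_one, Complex.ofReal_one, one_smul (M := ℂ) (star w)]
      rw [mul_sub R, sub_mul, mul_one, ← mul_assoc R, mul_assoc (R * R') (w - _), this,
        mul_assoc (R * R'), mul_sub w, hw']
      abel
    rw [hR1]
    exact ((hR'.comp_clm _).clm_comp R).add hR
  · have hlt : (t : ℝ) < 1 := lt_of_le_of_ne t.2.2 fun h => ht (Subtype.ext h)
    have hn : ‖star w‖ ≤ 1 := by
      rw [norm_star]
      refine w.opNorm_le_bound zero_le_one fun x => ?_
      rw [one_mul]
      apply le_of_eq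
      have : ‖w x‖ ^ 2 = ‖x‖ ^ 2 := by
        rw [← inner_self_eq_norm_sq (𝕜 := ℂ), ← inner_self_eq_norm_sq (𝕜 := ℂ),
          ← ContinuousLinearMap.adjoint_inner_left, ← ContinuousLinearMap.star_eq_adjoint,
          ← mul_apply_eq_comp, hw, one_apply_eq_self]
      exact (sq_eq_sq₀ (norm_nonneg _) (norm_nonneg _)).mp this
    -- Below `t = 1`, `w*(w - t w*) = 1 - t (w*)²` is inverted by a Neumann series.
    have hu : IsUnit (1 - ((t : ℝ) : ℂ) • (star w * star w)) := by
      apply isUnit_one_sub_of_norm_lt_one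
      rw [norm_smul, Complex.norm_real, Real.norm_of_nonneg t.2.1]
      have : ‖star w * star w‖ ≤ 1 := (norm_mul_le _ _).trans (mul_le_one₀ hn (norm_nonneg _) hn)
      have := mul_le_mul_of_nonneg_left this t.2.1
      linarith
    obtain ⟨u, hu⟩ := hu
    refine ⟨(u⁻¹ : (E →L[ℂ] E)ˣ) * star w, ?_⟩
    have : (u⁻¹ : (E →L[ℂ] E)ˣ) * star w * (w - ((t : ℝ) : ℂ) • star w) - 1 = 0 := by
      rw [mul_assoc, mul_sub, hw, mul_smul_comm, ← hu, Units.inv_mul, sub_self]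
    rw [this]
    exact isCompactOperator_zero

/-- The compression of `w - t w*` to the range of `p`, extended by the identity. -/
noncomputable def compressedPath (w p : E →L[ℂ] E) (t : unitInterval) : E →L[ℂ] E :=
  p * (w - ((t : ℝ) : ℂ) • star w) * p + (1 - p)

theorem continuous_compressedPath (w p : E →L[ℂ] E) : Continuous (compressedPath w p) := by
  unfold compressedPath
  fun_prop

theorem star_compressedPath {w p : E →L[ℂ] E} (hp : star p = p) (t : unitInterval) :
    star (compressedPath w p t) = p * (star w - ((t : ℝ) : ℂ) • w) * p + (1 - p) := by
  simp [compressedPath, hp, mul_assoc]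

theorem compressedPath_apply (w p : E →L[ℂ] E) (t : unitInterval) (x : E) :
    compressedPath w p t x
      = p (w (p x)) - ((t : ℝ) : ℂ) • p (star w (p x)) + (x - p x) := by
  simp [compressedPath]

theorem star_compressedPath_apply {w p : E →L[ℂ] E} (hp : star p = p) (t : unitInterval) (x : E) :
    star (compressedPath w p t) x
      = p (star w (p x)) - ((t : ℝ) : ℂ) • p (w (p x)) + (x - p x) := by
  rw [star_compressedPath hp]
  simp

/-- Essential locality makes both `(1 - p) w p` and `(1 - p) w* p` compact, so the gaps of `w`
survive compression. -/
theorem leftParametrix_compressedPath {w p : E →L[ℂ] E} (hw : star w * w = 1)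
    (hw' : w * star w = 1) (hpp : p * p = p) (hpw : IsCompactOperator (p - w * p * star w))
    (h1 : EssGapAt w 1) (h2 : EssGapAt w (-1)) (t : unitInterval) :
    ∃ R : E →L[ℂ] E, IsCompactOperator (R * compressedPath w p t - 1 : E →L[ℂ] E) := by
  obtain ⟨R, hR⟩ := leftParametrix_sub_smul_star hw hw' h1 h2 t
  refine ⟨_, leftParametrix_compression hpp hR ?_⟩
  have e : (1 - p) * (w - ((t : ℝ) : ℂ) • star w) * p
      = -((p - w * p * star w) * (w * p))
        - ((t : ℝ) : ℂ) • (star w * ((p - w * p * star w) * p)) := by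
    have a1 : (p - w * p * star w) * (w * p) = p * w * p - w * p := by
      rw [sub_mul, ← mul_assoc, mul_assoc (w * p), ← mul_assoc (star w), hw, one_mul, mul_assoc w,
        hpp]
    have a2 : star w * ((p - w * p * star w) * p) = star w * p - p * star w * p := by
      rw [sub_mul, mul_sub, hpp, ← mul_assoc, ← mul_assoc, ← mul_assoc, hw, one_mul]
    rw [a1, a2, mul_sub, sub_mul, mul_smul_comm, smul_mul_assoc]
    rw [sub_mul 1 p w, sub_mul _ _ p, one_mul, sub_mul 1 p (star w), sub_mul _ _ p, one_mul,
      neg_sub]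
  rw [e]
  have c1 := (hpw.comp_clm (w * p)).neg
  have c2 := ((hpw.comp_clm p).clm_comp (star w)).smul ((t : ℝ) : ℂ)
  exact c1.sub c2

/-- The adjoint of the path for `w` is the path for `w*`, which inherits the gaps and the locality.
-/
theorem leftParametrix_star_compressedPath {w p : E →L[ℂ] E} (hw : star w * w = 1)
    (hw' : w * star w = 1) (hpp : p * p = p) (hp : star p = p)
    (hpw : IsCompactOperator (p - w * p * star w))
    (h1 : EssGapAt w 1) (h2 : EssGapAt w (-1)) (t : unitInterval) :
    ∃ R : E →L[ℂ] E, IsCompactOperator (R * star (compressedPath w p t) - 1 : E →L[ℂ] E) := by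
  have hpw' : IsCompactOperator (p - star w * p * star (star w) : E →L[ℂ] E) := by
    have e : p - star w * p * star (star w) = -(star w * ((p - w * p * star w) * w)) := by
      rw [sub_mul, mul_sub, star_star, mul_assoc (w * p), hw, mul_one, ← mul_assoc (star w) w, hw,
        one_mul, neg_sub, mul_assoc]
    rw [e]
    exact ((hpw.comp_clm w).clm_comp (star w)).neg
  obtain ⟨R, hR⟩ := leftParametrix_compressedPath (w := star w) (by rwa [star_star])
    (by rwa [star_star]) hpp hpw' (h1.star_of_unitary hw hw' (by norm_num))
    (h2.star_of_unitary hw hw' (by norm_num)) t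
  refine ⟨R, ?_⟩
  rw [star_compressedPath hp]
  rwa [compressedPath, star_star] at hR

theorem mem_ker_compressedPath {w p : E →L[ℂ] E} (hpp : p * p = p) (t : unitInterval) (x : E) :
    compressedPath w p t x = 0 ↔ p x = x ∧ p (w x) = ((t : ℝ) : ℂ) • p (star w x) := by
  have h1 : ∀ x, p (p x) = p x := fun x => by rw [← mul_apply_eq_comp, hpp]
  rw [compressedPath_apply]
  constructor
  · intro h
    have hp := congrArg p h
    simp only [map_add, map_sub, map_smul, h1, sub_self, add_zero, map_zero] at hp
    rw [hp, zero_add, sub_eq_zero] at h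
    rw [← h, sub_eq_zero] at hp
    exact ⟨h.symm, hp⟩
  · rintro ⟨h, h'⟩
    rw [h, h', sub_self, sub_self, add_zero]

theorem mem_ker_star_compressedPath {w p : E →L[ℂ] E} (hpp : p * p = p) (hp : star p = p)
    (t : unitInterval) (x : E) :
    star (compressedPath w p t) x = 0 ↔ p x = x ∧ p (star w x) = ((t : ℝ) : ℂ) • p (w x) := by
  have := mem_ker_compressedPath (w := star w) hpp t x
  rw [star_star] at this
  rw [← this, star_compressedPath hp, compressedPath, star_star]

end Compression

/-! ### The parity in type DIII. -/

section Chiral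

variable {E : Type*} [NormedAddCommGroup E] [InnerProductSpace ℂ E] [CompleteSpace E]

/-- The `ℤ/2` index of a half-space compression vanishes in the presence of a real chiral symmetry
`g` with `g² = -1`. -/
theorem even_finrank_ker_compressedPath_of_chiral {η : E →ₗ⋆[ℂ] E} (hη : IsConjugation η)
    {g w p : E →L[ℂ] E} (hg : star g = -g) (hgg : g * g = -1) (hgp : g * p = p * g)
    (hgw : g * w = star w * g) (hw : star w * w = 1) (hw' : w * star w = 1)
    (hpp : p * p = p) (hp : star p = p) (hgη : ∀ x, g (η x) = η (g x))
    (hwη : ∀ x, w (η x) = η (w x)) (hwη' : ∀ x, star w (η x) = η (star w x))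
    (hpη : ∀ x, p (η x) = η (p x))
    (hpw : IsCompactOperator (p - w * p * star w)) (h1 : EssGapAt w 1) (h2 : EssGapAt w (-1)) :
    Even (Module.finrank ℂ (compressedPath w p 0).ker) := by
  have hgw' : g * star w = w * g := by
    have := congrArg (fun z => w * z * star w) hgw
    simp only [← mul_assoc, hw', one_mul] at this
    rw [mul_assoc _ w, hw', mul_one] at this
    exact this.symm
  have hginv : ∀ x, g x = 0 → x = 0 := by
    intro x hx
    have h := congrArg (fun z : E →L[ℂ] E => z x) hgg
    simp only [mul_apply_eq_comp, hx, map_zero, neg_apply, one_apply_eq_self] at h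
    exact neg_eq_zero.mp h.symm
  have hker : ∀ t, (g * compressedPath w p t).ker = (compressedPath w p t).ker := by
    intro t
    ext x
    constructor
    · exact fun h => hginv _ h
    · intro h
      have h : compressedPath w p t x = 0 := h
      change g (compressedPath w p t x) = 0
      rw [h, map_zero]
  -- Since `g` intertwines `w` with `w*` and commutes with `p`, it intertwines `T_t` with its
  -- adjoint; with `g* = -g` this makes `g T_t` skew-adjoint.
  have hpath := even_finrank_ker_path hη (fun t => g * compressedPath w p t)
    (continuous_const.mul (continuous_compressedPath w p))
    (fun t => by
      have a1 : ∀ x, g (p x) = p (g x) := fun x => congrArg (fun z : E →L[ℂ] E => z x) hgp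
      have a2 : ∀ x, g (w x) = star w (g x) := fun x => congrArg (fun z : E →L[ℂ] E => z x) hgw
      have a3 : ∀ x, g (star w x) = w (g x) := fun x => congrArg (fun z : E →L[ℂ] E => z x) hgw'
      rw [star_mul, hg, mul_neg, neg_inj]
      ext x
      simp only [mul_apply_eq_comp, star_compressedPath_apply hp, compressedPath_apply, map_add,
        map_sub, map_smul, a1, a2, a3])
    (fun t x => by
      simp only [mul_apply_eq_comp, compressedPath_apply, hpη, hwη, hwη']
      simp only [map_add, map_sub, map_smulₛₗ, RingHom.id_apply, Complex.conj_ofReal, hgη])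
    (fun t => by
      obtain ⟨R, hR⟩ := leftParametrix_compressedPath hw hw' hpp hpw h1 h2 t
      refine ⟨R * -g, ?_⟩
      rw [mul_assoc R, ← mul_assoc (-g), neg_mul, hgg, neg_neg, one_mul]
      exact hR)
  beta_reduce at hpath
  rw [hker, hker] at hpath
  have hfd : FiniteDimensional ℂ (compressedPath w p 1).ker := by
    obtain ⟨R, hR⟩ := leftParametrix_compressedPath hw hw' hpp hpw h1 h2 1
    exact finiteDimensional_ker_of_leftParametrix hR
  have hηK : ∀ x ∈ (compressedPath w p 1).ker, η x ∈ (compressedPath w p 1).ker := by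
    intro x hx
    have hx := (mem_ker_compressedPath hpp 1 x).mp hx
    refine (mem_ker_compressedPath hpp 1 _).mpr ?_
    simp only [Set.Icc.coe_one, Complex.ofReal_one, one_smul, hpη, hwη, hwη'] at hx ⊢
    exact ⟨congrArg η hx.1, congrArg η hx.2⟩
  have hgK : ∀ x ∈ (compressedPath w p 1).ker, g x ∈ (compressedPath w p 1).ker := by
    intro x hx
    have hx := (mem_ker_compressedPath hpp 1 x).mp hx
    refine (mem_ker_compressedPath hpp 1 _).mpr ?_
    have a1 : ∀ x, p (g x) = g (p x) := fun x => congrArg (fun z : E →L[ℂ] E => z x) hgp.symm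
    have a2 : ∀ x, w (g x) = g (star w x) := fun x =>
      congrArg (fun z : E →L[ℂ] E => z x) hgw'.symm
    have a3 : ∀ x, star w (g x) = g (w x) := fun x =>
      congrArg (fun z : E →L[ℂ] E => z x) hgw.symm
    simp only [Set.Icc.coe_one, Complex.ofReal_one, one_smul, a1, a2, a3] at hx ⊢
    exact ⟨congrArg g hx.1, congrArg g hx.2.symm⟩
  -- At `t = 1` the kernel condition `p w x = p w* x` is symmetric in `w` and `w*`, so `g` and `η`
  -- both act on the kernel. There `⟪η n, g m⟫` is alternating, and testing against `η (g x)` shows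
  -- nondegeneracy.
  have hev : Even (Module.finrank ℂ (compressedPath w p 1).ker) := by
    let B : LinearMap.BilinForm ℂ (compressedPath w p 1).ker :=
      LinearMap.mk₂ ℂ (fun m n => ⟪η n, g m⟫_ℂ)
        (fun a b d => by simp) (fun a b d => by simp)
        (fun a b d => by simp) (fun a b d => by simp [mul_comm])
    refine even_finrank_of_nondegenerate B.flip (fun x => hη.inner_self_of_skew hg hgη x) ?_
    intro x hx
    have := hx ⟨η (g x), hηK _ (hgK _ x.2)⟩
    change ⟪η (η (g x)), g x⟫_ℂ = 0 at this
    rw [hη.apply_apply, inner_self_eq_zero] at this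
    exact Subtype.ext (hginv _ this)
  rw [Nat.even_add] at hpath
  exact hpath.mpr hev

end Chiral

/-! ### The parity in type D, by doubling the space. -/

section OffDiag

variable {E : Type*} [NormedAddCommGroup E] [InnerProductSpace ℂ E]

/-- The first inclusion into the Hilbert sum `E ⊕ E`. -/
noncomputable def sumInl (E : Type*) [NormedAddCommGroup E] [InnerProductSpace ℂ E] :
    E →L[ℂ] WithLp 2 (E × E) :=
  ((WithLp.prodContinuousLinearEquiv 2 ℂ E E).symm : E × E →L[ℂ] WithLp 2 (E × E)).comp
    (ContinuousLinearMap.inl ℂ E E)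

/-- The second inclusion into the Hilbert sum `E ⊕ E`. -/
noncomputable def sumInr (E : Type*) [NormedAddCommGroup E] [InnerProductSpace ℂ E] :
    E →L[ℂ] WithLp 2 (E × E) :=
  ((WithLp.prodContinuousLinearEquiv 2 ℂ E E).symm : E × E →L[ℂ] WithLp 2 (E × E)).comp
    (ContinuousLinearMap.inr ℂ E E)

/-- The off-diagonal operator `(x, y) ↦ (A y, B x)` on the Hilbert sum `E ⊕ E`. -/
noncomputable def offDiag (A B : E →L[ℂ] E) : WithLp 2 (E × E) →L[ℂ] WithLp 2 (E × E) :=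
  (sumInl E).comp (A.comp (WithLp.sndL 2 ℂ E E)) + (sumInr E).comp (B.comp (WithLp.fstL 2 ℂ E E))

theorem offDiag_apply (A B : E →L[ℂ] E) (x : WithLp 2 (E × E)) :
    offDiag A B x = WithLp.toLp 2 (A x.snd, B x.fst) := by
  apply (WithLp.prodContinuousLinearEquiv 2 ℂ E E).injective
  ext <;> simp [offDiag, sumInl, sumInr]

theorem leftParametrix_offDiag {A B R R' : E →L[ℂ] E}
    (hA : IsCompactOperator (R * A - 1 : E →L[ℂ] E))
    (hB : IsCompactOperator (R' * B - 1 : E →L[ℂ] E)) :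
    IsCompactOperator (offDiag R' R * offDiag A B - 1 :
      WithLp 2 (E × E) →L[ℂ] WithLp 2 (E × E)) := by
  have e : (offDiag R' R * offDiag A B - 1 : WithLp 2 (E × E) →L[ℂ] WithLp 2 (E × E))
      = (sumInl E).comp ((R' * B - 1).comp (WithLp.fstL 2 ℂ E E))
        + (sumInr E).comp ((R * A - 1).comp (WithLp.sndL 2 ℂ E E)) := by
    ext x
    apply (WithLp.prodContinuousLinearEquiv 2 ℂ E E).injective
    ext <;> simp [offDiag_apply, sumInl, sumInr]
  rw [e]
  exact ((hB.comp_clm (WithLp.fstL 2 ℂ E E)).clm_comp (sumInl E)).add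
    ((hA.comp_clm (WithLp.sndL 2 ℂ E E)).clm_comp (sumInr E))

/-- The conjugation `η ⊕ η`. -/
noncomputable def sumConj (η : E →ₗ⋆[ℂ] E) : WithLp 2 (E × E) →ₗ⋆[ℂ] WithLp 2 (E × E) where
  toFun x := WithLp.toLp 2 (η x.fst, η x.snd)
  map_add' x y := by
    apply (WithLp.prodContinuousLinearEquiv 2 ℂ E E).injective
    ext <;> simp
  map_smul' c x := by
    apply (WithLp.prodContinuousLinearEquiv 2 ℂ E E).injective
    ext <;> simp

theorem sumConj_apply (η : E →ₗ⋆[ℂ] E) (x : WithLp 2 (E × E)) :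
    sumConj η x = WithLp.toLp 2 (η x.fst, η x.snd) := rfl

theorem IsConjugation.sumConj {η : E →ₗ⋆[ℂ] E} (hη : IsConjugation η) :
    IsConjugation (sumConj η) where
  apply_apply x := by
    apply (WithLp.prodContinuousLinearEquiv 2 ℂ E E).injective
    ext <;> simp [sumConj_apply, hη.apply_apply]
  inner_comm x y := by
    simp only [sumConj_apply, WithLp.prod_inner_apply]
    exact congrArg₂ _ (hη.inner_comm x.fst y.fst) (hη.inner_comm x.snd y.snd)

/-- The kernel of an off-diagonal operator is the sum of the kernels of its entries. -/
noncomputable def offDiagKerEquiv (A B : E →L[ℂ] E) : (offDiag A B).ker ≃ₗ[ℂ] B.ker × A.ker where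
  toFun x := (⟨x.1.fst, by
      have h : offDiag A B x.1 = 0 := x.2
      rw [offDiag_apply] at h
      exact congrArg WithLp.snd h⟩, ⟨x.1.snd, by
      have h : offDiag A B x.1 = 0 := x.2
      rw [offDiag_apply] at h
      exact congrArg WithLp.fst h⟩)
  map_add' x y := rfl
  map_smul' c x := rfl
  invFun x := ⟨WithLp.toLp 2 (x.1, x.2), by
    have h1 : B x.1 = 0 := x.1.2
    have h2 : A x.2 = 0 := x.2.2
    change offDiag A B _ = 0
    rw [offDiag_apply]
    simp [h1, h2]⟩
  left_inv x := rfl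
  right_inv x := rfl

theorem finrank_ker_offDiag (A B : E →L[ℂ] E) [FiniteDimensional ℂ A.ker]
    [FiniteDimensional ℂ B.ker] : Module.finrank ℂ (offDiag A B).ker
      = Module.finrank ℂ B.ker + Module.finrank ℂ A.ker := by
  rw [(offDiagKerEquiv A B).finrank_eq, Module.finrank_prod]

variable [CompleteSpace E]

theorem star_offDiag (A B : E →L[ℂ] E) : star (offDiag A B) = offDiag (star B) (star A) := by
  rw [ContinuousLinearMap.star_eq_adjoint, eq_comm, ContinuousLinearMap.eq_adjoint_iff]
  intro x y
  simp only [offDiag_apply, WithLp.prod_inner_apply, ContinuousLinearMap.star_eq_adjoint,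
    ContinuousLinearMap.adjoint_inner_left]
  exact add_comm _ _

/-- The kernels of a real half-space compression of a gapped unitary and of its adjoint have
dimensions of the same parity. -/
theorem even_finrank_ker_compressedPath_add {η : E →ₗ⋆[ℂ] E} (hη : IsConjugation η)
    {w p : E →L[ℂ] E} (hw : star w * w = 1) (hw' : w * star w = 1)
    (hpp : p * p = p) (hp : star p = p)
    (hwη : ∀ x, w (η x) = η (w x)) (hwη' : ∀ x, star w (η x) = η (star w x))
    (hpη : ∀ x, p (η x) = η (p x))
    (hpw : IsCompactOperator (p - w * p * star w)) (h1 : EssGapAt w 1) (h2 : EssGapAt w (-1)) :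
    Even (Module.finrank ℂ (compressedPath w p 0).ker
      + Module.finrank ℂ (star (compressedPath w p 0)).ker) := by
  have hfd : ∀ t, FiniteDimensional ℂ (compressedPath w p t).ker := by
    intro t
    obtain ⟨R, hR⟩ := leftParametrix_compressedPath hw hw' hpp hpw h1 h2 t
    exact finiteDimensional_ker_of_leftParametrix hR
  have hneg : ∀ A : E →L[ℂ] E, (-A).ker = A.ker := by
    intro A
    ext x
    exact neg_eq_zero
  have hfd' : ∀ t, FiniteDimensional ℂ (-star (compressedPath w p t)).ker := by
    intro t
    obtain ⟨R, hR⟩ := leftParametrix_star_compressedPath hw hw' hpp hp hpw h1 h2 t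
    rw [hneg]
    exact finiteDimensional_ker_of_leftParametrix hR
  have hpath := even_finrank_ker_path hη.sumConj
    (fun t => offDiag (compressedPath w p t) (-star (compressedPath w p t)))
    (by
      have := continuous_compressedPath w p
      unfold offDiag
      fun_prop)
    (fun t => by
      rw [star_offDiag, star_neg, star_star]
      ext x
      apply (WithLp.prodContinuousLinearEquiv 2 ℂ E E).injective
      ext <;> simp [offDiag_apply])
    (fun t x => by
      apply (WithLp.prodContinuousLinearEquiv 2 ℂ E E).injective
      rw [offDiag_apply, sumConj_apply, sumConj_apply, offDiag_apply]
      ext <;> simp only [WithLp.prodContinuousLinearEquiv_apply, WithLp.toLp_fst,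
        WithLp.toLp_snd, neg_apply, star_compressedPath_apply hp,
        compressedPath_apply, map_add, map_sub, map_neg, map_smulₛₗ,
        Complex.conj_ofReal, hpη, hwη, hwη'])
    (fun t => by
      obtain ⟨R, hR⟩ := leftParametrix_compressedPath hw hw' hpp hpw h1 h2 t
      obtain ⟨R', hR'⟩ := leftParametrix_star_compressedPath hw hw' hpp hp hpw h1 h2 t
      exact ⟨_, leftParametrix_offDiag (R' := -R') hR (by rwa [neg_mul_neg])⟩)
  beta_reduce at hpath
  rw [finrank_ker_offDiag, finrank_ker_offDiag, hneg, hneg] at hpath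
  -- At the endpoint both kernels are given by `p w x = p w* x` on the range of `p`, so the doubled
  -- kernel has even dimension.
  have hker : (star (compressedPath w p 1)).ker = (compressedPath w p 1).ker := by
    ext x
    refine (mem_ker_star_compressedPath hpp hp 1 x).trans
      (Iff.trans ?_ (mem_ker_compressedPath hpp 1 x).symm)
    simp only [Set.Icc.coe_one, Complex.ofReal_one, one_smul]
    exact and_congr_right' eq_comm
  rw [hker, Nat.even_add, add_comm] at hpath
  exact hpath.mpr ⟨_, rfl⟩

end OffDiag

/-! ### Complex structures commuting with an antiunitary operator. -/

section Structure

variable {E : Type*} [NormedAddCommGroup E] [InnerProductSpace ℂ E]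

theorem exists_unit_mem {N : Submodule ℂ E} (hN : N ≠ ⊥) : ∃ e ∈ N, ⟪e, e⟫_ℂ = 1 := by
  obtain ⟨v, hv, hv0⟩ := N.ne_bot_iff.mp hN
  refine ⟨((‖v‖⁻¹ : ℝ) : ℂ) • v, N.smul_mem _ hv, ?_⟩
  have h : (‖v‖ : ℂ) ≠ 0 := by exact_mod_cast norm_ne_zero_iff.mpr hv0
  rw [inner_smul_left, inner_smul_right, inner_self_eq_norm_sq_to_K, Complex.conj_ofReal]
  push_cast
  field_simp
  rfl

/-- A subspace that is invariant under a conjugation contains a real unit vector. -/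
theorem exists_real_unit_mem {η : E →ₗ⋆[ℂ] E} (hηη : ∀ x, η (η x) = x) {N : Submodule ℂ E}
    (hN : N ≠ ⊥) (hηN : ∀ x ∈ N, η x ∈ N) : ∃ e ∈ N, ⟪e, e⟫_ℂ = 1 ∧ η e = e := by
  have key : ∃ v ∈ N, v ≠ 0 ∧ η v = v := by
    obtain ⟨v, hv, hv0⟩ := N.ne_bot_iff.mp hN
    by_cases h : v + η v = 0
    · refine ⟨Complex.I • v, N.smul_mem _ hv, smul_ne_zero Complex.I_ne_zero hv0, ?_⟩
      rw [map_smulₛₗ, eq_neg_of_add_eq_zero_right h, Complex.conj_I, neg_smul_neg]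
    · exact ⟨_, N.add_mem hv (hηN v hv), h, by rw [map_add, hηη, add_comm]⟩
  obtain ⟨v, hv, hv0, hηv⟩ := key
  refine ⟨((‖v‖⁻¹ : ℝ) : ℂ) • v, N.smul_mem _ hv, ?_, ?_⟩
  · have h : (‖v‖ : ℂ) ≠ 0 := by exact_mod_cast norm_ne_zero_iff.mpr hv0
    rw [inner_smul_left, inner_smul_right, inner_self_eq_norm_sq_to_K, Complex.conj_ofReal]
    push_cast
    field_simp
    rfl
  · rw [map_smulₛₗ, hηv, Complex.conj_ofReal]

/-- An orthonormal pair in `N` adapted to an antiunitary `η`. -/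
theorem exists_adapted_pair {η : E →ₗ⋆[ℂ] E} (hη : ∀ x y, ⟪η x, η y⟫_ℂ = ⟪y, x⟫_ℂ)
    (N : Submodule ℂ E) [FiniteDimensional ℂ N] (hηN : ∀ x ∈ N, η x ∈ N) (hN : N ≠ ⊥)
    (hsq : ((∀ x, η (η x) = x) ∧ Even (Module.finrank ℂ N)) ∨ ∀ x, η (η x) = -x) :
    ∃ e ∈ N, ∃ f ∈ N, ⟪e, e⟫_ℂ = 1 ∧ ⟪f, f⟫_ℂ = 1 ∧ ⟪e, f⟫_ℂ = 0 ∧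
      ((η e = e ∧ η f = f) ∨ (η e = f ∧ η f = -e)) := by
  rcases hsq with ⟨hsq, hev⟩ | hsq
  · obtain ⟨e, heN, he, hηe⟩ := exists_real_unit_mem hsq hN hηN
    have hdim := Submodule.finrank_add_inf_finrank_orthogonal
      (K₁ := Submodule.span ℂ {e}) (K₂ := N) (by simpa using heN)
    have he0 : e ≠ 0 := by
      rintro rfl
      simp at he
    rw [finrank_span_singleton he0] at hdim
    -- Even dimension leaves room for a second real vector after removing the line of `e`.
    have hN' : (Submodule.span ℂ {e})ᗮ ⊓ N ≠ ⊥ := by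
      intro h0
      rw [h0, finrank_bot] at hdim
      rw [← hdim] at hev
      exact absurd hev (by decide)
    obtain ⟨f, hfN, hf, hηf⟩ := exists_real_unit_mem hsq hN' (fun x hx => by
      refine ⟨?_, hηN x hx.2⟩
      have := Submodule.mem_orthogonal_singleton_iff_inner_right.mp hx.1
      refine Submodule.mem_orthogonal_singleton_iff_inner_right.mpr ?_
      rw [← hηe, hη, ← inner_conj_symm, this, map_zero])
    exact ⟨e, heN, f, hfN.2, he, hf,
      Submodule.mem_orthogonal_singleton_iff_inner_right.mp hfN.1, Or.inl ⟨hηe, hηf⟩⟩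
  · obtain ⟨e, heN, he⟩ := exists_unit_mem hN
    refine ⟨e, heN, η e, hηN e heN, he, by rw [hη, he], ?_, Or.inr ⟨rfl, hsq e⟩⟩
    have h := hη e (η e)
    rw [hsq, inner_neg_right, ← inner_conj_symm (η e) e] at h
    have h2 := hη (η e) e
    rw [hsq, inner_neg_left] at h2
    linear_combination - h2 / 2

/-- A finite dimensional subspace which is invariant under an antiunitary `η` with `η² = -1`, or
with `η² = 1` and even dimension, carries a skew-adjoint complex structure commuting with `η`. -/
theorem exists_skew_complexStructure {η : E →ₗ⋆[ℂ] E} (hη : ∀ x y, ⟪η x, η y⟫_ℂ = ⟪y, x⟫_ℂ)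
    (n : ℕ) : ∀ (N : Submodule ℂ E) [FiniteDimensional ℂ N], Module.finrank ℂ N = n →
    (∀ x ∈ N, η x ∈ N) → (((∀ x, η (η x) = x) ∧ Even n) ∨ ∀ x, η (η x) = -x) →
    ∃ B : E →ₗ[ℂ] E, (∀ x y, ⟪B x, y⟫_ℂ = -⟪x, B y⟫_ℂ) ∧ (∀ x, B x ∈ N) ∧
      (∀ x ∈ N, B (B x) = -x) ∧ ∀ x, B (η x) = η (B x) := by
  induction n using Nat.strong_induction_on with
  | _ n ih =>
  intro N _ hn hηN hsq
  by_cases hN : N = ⊥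
  · refine ⟨0, by simp, by simp, ?_, by simp⟩
    intro x hx
    rw [hN, Submodule.mem_bot] at hx
    simp [hx]
  obtain ⟨e, heN, f, hfN, he, hf, hef, hηef⟩ := exists_adapted_pair hη N hηN hN (by rwa [hn])
  have hfe : ⟪f, e⟫_ℂ = 0 := by rw [← inner_conj_symm, hef, map_zero]
  have hon : Orthonormal ℂ ![e, f] := by
    rw [orthonormal_iff_ite]
    intro i j
    fin_cases i <;> fin_cases j
    · exact he
    · exact hef
    · exact hfe
    · exact hf
  set M := Submodule.span ℂ (Set.range ![e, f]) with hM
  have hfinM : Module.finrank ℂ M = 2 := by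
    rw [hM, finrank_span_eq_card hon.linearIndependent, Fintype.card_fin]
  have hMN : M ≤ N := by
    rw [hM, Submodule.span_le]
    rintro _ ⟨i, rfl⟩
    fin_cases i
    · exact heN
    · exact hfN
  have hMo : ∀ x, x ∈ Mᗮ ↔ ⟪e, x⟫_ℂ = 0 ∧ ⟪f, x⟫_ℂ = 0 := by
    intro x
    constructor
    · intro h
      exact ⟨h e (Submodule.subset_span ⟨0, rfl⟩), h f (Submodule.subset_span ⟨1, rfl⟩)⟩
    · rintro ⟨h1, h2⟩
      have : M ≤ (Submodule.span ℂ {x})ᗮ := by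
        rw [hM, Submodule.span_le]
        rintro _ ⟨i, rfl⟩
        refine Submodule.mem_orthogonal_singleton_iff_inner_left.mpr ?_
        fin_cases i
        · exact h1
        · exact h2
      exact fun y hy => Submodule.mem_orthogonal_singleton_iff_inner_left.mp (this hy)
  have hdim := Submodule.finrank_add_inf_finrank_orthogonal hMN
  rw [hfinM, hn] at hdim
  have hswap : ∀ x, (⟪e, η x⟫_ℂ = ⟪x, e⟫_ℂ ∧ ⟪f, η x⟫_ℂ = ⟪x, f⟫_ℂ ∧ η e = e ∧ η f = f) ∨
      (⟪e, η x⟫_ℂ = -⟪x, f⟫_ℂ ∧ ⟪f, η x⟫_ℂ = ⟪x, e⟫_ℂ ∧ η e = f ∧ η f = -e) := by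
    intro x
    have a1 := hη e x
    have a2 := hη f x
    rcases hηef with ⟨h1, h2⟩ | ⟨h1, h2⟩
    · rw [h1] at a1
      rw [h2] at a2
      exact Or.inl ⟨a1, a2, h1, h2⟩
    · rw [h1] at a1
      rw [h2, inner_neg_left] at a2
      exact Or.inr ⟨by rw [← a2, neg_neg], a1, h1, h2⟩
  have hfd : FiniteDimensional ℂ (Mᗮ ⊓ N : Submodule ℂ E) :=
    Submodule.finiteDimensional_of_le inf_le_right
  obtain ⟨B, hB1, hB2, hB3, hB4⟩ := ih (n - 2) (by omega) (Mᗮ ⊓ N) (by omega)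
    (fun x hx => by
      refine ⟨(hMo _).mpr ?_, hηN x hx.2⟩
      obtain ⟨b1, b2⟩ := (hMo x).mp hx.1
      have b1' : ⟪x, e⟫_ℂ = 0 := by rw [← inner_conj_symm, b1, map_zero]
      have b2' : ⟪x, f⟫_ℂ = 0 := by rw [← inner_conj_symm, b2, map_zero]
      rcases hswap x with ⟨h1, h2, -⟩ | ⟨h1, h2, -⟩
      · exact ⟨by rw [h1, b1'], by rw [h2, b2']⟩
      · exact ⟨by rw [h1, b2', neg_zero], by rw [h2, b1']⟩)
    (by
      rcases hsq with ⟨h1, h2⟩ | h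
      · refine Or.inl ⟨h1, ?_⟩
        rw [Nat.even_iff] at h2 ⊢
        omega
      · exact Or.inr h)
  have hBo : ∀ x, ⟪e, B x⟫_ℂ = 0 ∧ ⟪f, B x⟫_ℂ = 0 := fun x => (hMo _).mp (hB2 x).1
  have hB0 : ∀ y, (∀ x, ⟪y, B x⟫_ℂ = 0) → B y = 0 := by
    intro y hy
    rw [← inner_self_eq_zero (𝕜 := ℂ), hB1, hy, neg_zero]
  have hBe : B e = 0 := hB0 e fun x => (hBo x).1
  have hBf : B f = 0 := hB0 f fun x => (hBo x).2
  -- On the plane of `e` and `f` this adds the quarter turn `e ↦ f`, `f ↦ -e`. It commutes with `η`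
  -- both when `η` fixes `e` and `f` and when `η` itself acts as this turn on the basis.
  let C : E →ₗ[ℂ] E := B + ((innerₛₗ ℂ e).smulRight f - (innerₛₗ ℂ f).smulRight e)
  have hC : ∀ x, C x = B x + (⟪e, x⟫_ℂ • f - ⟪f, x⟫_ℂ • e) := fun x => rfl
  refine ⟨C, ?_, ?_, ?_, ?_⟩
  · intro x y
    rw [hC, hC, inner_add_left, inner_add_right, hB1, inner_sub_left, inner_sub_right,
      inner_smul_left, inner_smul_left, inner_smul_right, inner_smul_right, inner_conj_symm,
      inner_conj_symm]
    ring
  · intro x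
    rw [hC]
    exact N.add_mem (hB2 x).2 (N.sub_mem (N.smul_mem _ hfN) (N.smul_mem _ heN))
  · intro x hx
    have hy : x - ⟪e, x⟫_ℂ • e - ⟪f, x⟫_ℂ • f ∈ Mᗮ ⊓ N := by
      refine ⟨(hMo _).mpr ⟨?_, ?_⟩, N.sub_mem (N.sub_mem hx (N.smul_mem _ heN)) (N.smul_mem _ hfN)⟩
      · rw [inner_sub_right, inner_sub_right, inner_smul_right, inner_smul_right, he, hef]
        ring
      · rw [inner_sub_right, inner_sub_right, inner_smul_right, inner_smul_right, hf, hfe]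
        ring
    have hBB := hB3 _ hy
    simp only [map_sub, map_smul, hBe, hBf, smul_zero, sub_zero] at hBB
    rw [hC (C x), hC x]
    simp only [map_add, map_sub, map_smul, hBe, hBf, smul_zero, sub_zero, add_zero, hBB,
      inner_add_right, inner_sub_right, inner_smul_right, (hBo x).1, (hBo x).2, he, hf, hef, hfe,
      mul_zero, mul_one, zero_add, zero_sub]
    module
  · intro x
    rw [hC, hC, map_add, map_sub, map_smulₛₗ, map_smulₛₗ, inner_conj_symm, inner_conj_symm, hB4]
    congr 1
    rcases hswap x with ⟨h1, h2, h3, h4⟩ | ⟨h1, h2, h3, h4⟩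
    · rw [h1, h2, h3, h4]
    · rw [h1, h2, h3, h4]
      module

end Structure

/-! ### Unitary and antiunitary conjugation, and the functional calculus. -/

section Semilinear

variable {E : Type*} [NormedAddCommGroup E] [InnerProductSpace ℂ E]

/-- By polarization: antilinearity interchanges the two terms containing `i`, which amounts to
exchanging the arguments. -/
theorem inner_map_map_of_antiunitary (e : E ≃ₗᵢ⋆[ℂ] E) (x y : E) : ⟪e x, e y⟫_ℂ = ⟪y, x⟫_ℂ := by
  rw [inner_eq_sum_norm_sq_div_four, inner_eq_sum_norm_sq_div_four, ← map_add, ← map_sub]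
  have h1 : e x - (RCLike.I : ℂ) • e y = e (x + Complex.I • y) := by
    rw [map_add, map_smulₛₗ, Complex.conj_I, neg_smul, sub_eq_add_neg]
    rfl
  have h2 : e x + (RCLike.I : ℂ) • e y = e (x - Complex.I • y) := by
    rw [map_sub, map_smulₛₗ, Complex.conj_I, neg_smul, sub_neg_eq_add]
    rfl
  have h3 : ‖x + Complex.I • y‖ = ‖y - Complex.I • x‖ := by
    rw [← one_mul ‖y - Complex.I • x‖, ← Complex.norm_I, ← norm_smul, smul_sub, smul_smul,
      Complex.I_mul_I, neg_one_smul, sub_neg_eq_add, add_comm]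
  have h4 : ‖x - Complex.I • y‖ = ‖y + Complex.I • x‖ := by
    rw [← one_mul ‖y + Complex.I • x‖, ← Complex.norm_I, ← norm_smul, smul_add, smul_smul,
      Complex.I_mul_I, neg_one_smul, ← norm_neg]
    congr 1
    abel
  rw [h1, h2, e.norm_map, e.norm_map, e.norm_map, e.norm_map, h3, h4, add_comm x y, norm_sub_rev x y]
  rfl

variable {σ : ℂ →+* ℂ} [RingHomInvPair σ σ]

/-- A semilinear isometry is unitary or antiunitary: its inner products are determined by those of
the arguments. -/
def PreservesInner (e : E ≃ₛₗᵢ[σ] E) : Prop :=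
  ∀ x y u v, ⟪x, y⟫_ℂ = ⟪u, v⟫_ℂ → ⟪e x, e y⟫_ℂ = ⟪e u, e v⟫_ℂ

theorem preservesInner_of_unitary (e : E ≃ₗᵢ[ℂ] E) : PreservesInner e := fun x y u v h => by
  simpa using h

theorem preservesInner_of_antiunitary (e : E ≃ₗᵢ⋆[ℂ] E) : PreservesInner e := fun x y u v h => by
  rw [inner_map_map_of_antiunitary, inner_map_map_of_antiunitary, ← inner_conj_symm, h,
    inner_conj_symm]

variable [CompleteSpace E]

/-- Conjugation of operators by a unitary or antiunitary operator. -/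
noncomputable def conjHom (e : E ≃ₛₗᵢ[σ] E) (he : PreservesInner e) :
    (E →L[ℂ] E) →⋆ₐ[ℝ] (E →L[ℂ] E) where
  toFun T := ((e.toContinuousLinearEquiv : E →SL[σ] E).comp T).comp
    (e.symm.toContinuousLinearEquiv : E →SL[σ] E)
  map_one' := by ext x; simp
  map_mul' S T := by ext x; simp
  map_zero' := by ext x; simp
  map_add' S T := by ext x; simp
  commutes' r := by
    ext x
    simp only [Algebra.algebraMap_eq_smul_one]
    change e (r • e.symm x) = r • x
    rw [map_real_smul e e.continuous, e.apply_symm_apply]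
  map_star' T := by
    rw [ContinuousLinearMap.star_eq_adjoint, ContinuousLinearMap.star_eq_adjoint,
      ContinuousLinearMap.eq_adjoint_iff]
    intro x y
    change ⟪e (T.adjoint (e.symm x)), y⟫_ℂ = ⟪x, e (T (e.symm y))⟫_ℂ
    have := he _ _ _ _ (ContinuousLinearMap.adjoint_inner_left T (e.symm y) (e.symm x))
    rwa [e.apply_symm_apply, e.apply_symm_apply] at this

theorem conjHom_apply (e : E ≃ₛₗᵢ[σ] E) (he : PreservesInner e) (T : E →L[ℂ] E) (x : E) :
    conjHom e he T x = e (T (e.symm x)) := rfl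

theorem continuous_conjHom (e : E ≃ₛₗᵢ[σ] E) (he : PreservesInner e) :
    Continuous (conjHom e he) := by
  refine AddMonoidHomClass.continuous_of_bound (conjHom e he) 1 fun T => ?_
  refine ContinuousLinearMap.opNorm_le_bound _ (by positivity) fun x => ?_
  rw [conjHom_apply, e.norm_map, one_mul]
  exact (T.le_opNorm _).trans (by rw [e.symm.norm_map])

/-- The continuous functional calculus commutes with the unitary and antiunitary operators that
commute with its argument. -/
theorem map_cfc_of_commute (e : E ≃ₛₗᵢ[σ] E) (he : PreservesInner e) {D : E →L[ℂ] E}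
    (hD : IsSelfAdjoint D) (heD : ∀ x, e (D x) = D (e x)) {f : ℝ → ℝ} (hf : Continuous f) (x : E) :
    e (cfc f D x) = cfc f D (e x) := by
  have hφ : conjHom e he D = D := by
    ext x
    rw [conjHom_apply, heD, e.apply_symm_apply]
  -- Conjugation by an antiunitary operator is only real-linear, hence a star homomorphism over `ℝ`;
  -- the real functional calculus is all that is needed.
  have h := StarAlgHom.map_cfc (conjHom e he) f D hf.continuousOn (continuous_conjHom e he) hD
    (by rwa [hφ])
  rw [hφ] at h
  have := congrArg (fun T : E →L[ℂ] E => T (e x)) h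
  simpa [conjHom_apply] using this

end Semilinear

/-! ### The spectral gap at zero and the inverse square root. -/

section InvSqrt

variable {E : Type*} [NormedAddCommGroup E] [InnerProductSpace ℂ E] [CompleteSpace E]

/-- Zero is not an accumulation point of the spectrum of a self-adjoint operator which is invertible
modulo compact operators. -/
theorem exists_spectral_gap {D R : E →L[ℂ] E} (hD : IsSelfAdjoint D)
    (hR : IsCompactOperator (R * D - 1 : E →L[ℂ] E)) :
    ∃ δ > 0, ∀ t ∈ spectrum ℝ D, t ≠ 0 → δ ≤ |t| := by
  have hfd : FiniteDimensional ℂ D.ker := finiteDimensional_ker_of_leftParametrix hR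
  obtain ⟨hDp, -, hunit⟩ := isUnit_add_starProjection_ker hR (Or.inl hD.star_eq)
  set p := D.ker.starProjection with hp
  have hpp : p * p = p := D.ker.isIdempotentElem_starProjection
  have hev : ∀ᶠ t in nhds (0 : ℝ), IsUnit (D + p - t • (1 : E →L[ℂ] E)) := by
    have hc : Continuous fun t : ℝ => D + p - t • (1 : E →L[ℂ] E) := by fun_prop
    refine hc.continuousAt.eventually (Units.isOpen.mem_nhds ?_)
    change IsUnit _
    beta_reduce
    rwa [zero_smul, sub_zero]
  obtain ⟨δ, hδ, hball⟩ := Metric.eventually_nhds_iff.mp hev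
  refine ⟨min δ 1, by positivity, fun t ht ht0 => ?_⟩
  by_contra hlt
  rw [not_le, lt_min_iff] at hlt
  have hu := hball (y := t) (by simpa using hlt.1)
  have ht1 : (1 : ℝ) - t ≠ 0 := by
    have := (abs_lt.mp hlt.2).2
    linarith
  apply ht
  -- On the kernel, `D + p - t` acts as `1 - t` where `D - t` acts as `-t`; this quotient is the
  -- correction factor there, invertible because `t ≠ 0`.
  have hs : -t / (1 - t) ≠ 0 := div_ne_zero (neg_ne_zero.mpr ht0) ht1
  have hv : IsUnit ((1 - p) + (-t / (1 - t)) • p) := by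
    have a1 : ∀ a b : ℝ, ((1 - p) + a • p) * ((1 - p) + b • p) = (1 - p) + (a * b) • p := by
      intro a b
      have hp1 : p * (1 - p) = 0 := by rw [mul_sub, mul_one, hpp, sub_self]
      have hp2 : (1 - p) * p = 0 := by rw [sub_mul, one_mul, hpp, sub_self]
      have hp3 : (1 - p) * (1 - p) = 1 - p := by rw [mul_sub, mul_one, hp2, sub_zero]
      rw [add_mul, mul_add, mul_add, hp3, mul_smul_comm, hp2, smul_mul_assoc, hp1, smul_mul_assoc,
        mul_smul_comm, hpp, smul_smul, smul_zero, smul_zero, add_zero, zero_add]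
    refine ⟨⟨_, (1 - p) + (-t / (1 - t))⁻¹ • p, ?_, ?_⟩, rfl⟩
    · rw [a1, mul_inv_cancel₀ hs, one_smul, sub_add_cancel]
    · rw [a1, inv_mul_cancel₀ hs, one_smul, sub_add_cancel]
  have hprod : (D + p - t • (1 : E →L[ℂ] E)) * ((1 - p) + (-t / (1 - t)) • p)
      = D - t • 1 := by
    have b1 : (D + p - t • (1 : E →L[ℂ] E)) * p = (1 - t) • p := by
      rw [sub_mul, add_mul, hDp, hpp, zero_add, smul_mul_assoc, one_mul, sub_smul, one_smul]
    rw [mul_add, mul_sub, mul_one, mul_smul_comm, b1, smul_smul, div_mul_cancel₀ _ ht1]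
    module
  have := (hu.mul hv).neg
  rw [hprod, neg_sub] at this
  rwa [spectrum.mem_resolventSet_iff, Algebra.algebraMap_eq_smul_one]

/-- On the spectrum of `D ≥ 0`, the inverse square root agrees with a continuous function. -/
theorem exists_continuous_eqOn_inv_sqrt {D R : E →L[ℂ] E} (hD : 0 ≤ D)
    (hR : IsCompactOperator (R * D - 1 : E →L[ℂ] E)) :
    ∃ g : ℝ → ℝ, Continuous g ∧ (∀ t ∈ spectrum ℝ D, (Real.sqrt t)⁻¹ = g t) := by
  obtain ⟨δ, hδ, hgap⟩ := exists_spectral_gap (IsSelfAdjoint.of_nonneg hD) hR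
  -- This equals `1/√t` for `t ≥ δ` and `0` at `t = 0`, matching `(√0)⁻¹ = 0`; in between lies no
  -- spectrum.
  refine ⟨fun t => (Real.sqrt (max t δ))⁻¹ * (min t δ / δ), ?_, fun t ht => ?_⟩
  · refine Continuous.mul (Continuous.inv₀ (by fun_prop) fun t => ?_) (by fun_prop)
    exact (Real.sqrt_pos.mpr (lt_max_of_lt_right hδ)).ne'
  · rcases eq_or_ne t 0 with rfl | h0
    · simp [hδ.le]
    · have h1 := hgap t ht h0
      rw [abs_of_nonneg (spectrum_nonneg_of_nonneg hD ht)] at h1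
      beta_reduce
      rw [max_eq_left h1, min_eq_right h1, div_self hδ.ne', mul_one]

end InvSqrt

/-! ### The algebra of a pair of projections. -/

section ProjectionPair

variable {H : Type*} [NormedAddCommGroup H] [InnerProductSpace ℂ H]

theorem mem_jointSpace {P Q : H →L[ℂ] H} {i j : Fin 2} {x : H} :
    x ∈ jointSpace P Q i j ↔ P x = (i.val : ℂ) • x ∧ Q x = (j.val : ℂ) • x := Iff.rfl

theorem isClosed_jointSpace (P Q : H →L[ℂ] H) (i j : Fin 2) :
    IsClosed (jointSpace P Q i j : Set H) := by
  have : (jointSpace P Q i j : Set H)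
      = {x | P x = (i.val : ℂ) • x} ∩ {x | Q x = (j.val : ℂ) • x} := rfl
  rw [this]
  exact (isClosed_eq P.continuous (continuous_const_smul _)).inter
    (isClosed_eq Q.continuous (continuous_const_smul _))

/-- Applying `P` to `X x = 0` gives `PQx = 0`, whence `x = Qx + Px`; applying `Q` then gives `QPx =
0`, so this is the required splitting. -/
theorem ker_opX {P Q : H →L[ℂ] H} (hPP : P * P = P) (hQQ : Q * Q = Q) :
    (opX P Q).ker = jointSpace P Q 0 1 ⊔ jointSpace P Q 1 0 := by
  have h1 : ∀ x, P (P x) = P x := fun x => by rw [← mul_apply_eq_comp, hPP]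
  have h2 : ∀ x, Q (Q x) = Q x := fun x => by rw [← mul_apply_eq_comp, hQQ]
  have hX : ∀ x, opX P Q x = x - P x - Q x + (2 : ℂ) • P (Q x) := fun x => rfl
  apply le_antisymm
  · intro x hx
    have hx : opX P Q x = 0 := hx
    rw [hX] at hx
    have hPQ : P (Q x) = 0 := by
      have h := congrArg P hx
      simp only [map_add, map_sub, map_smul, h1, map_zero] at h
      rw [← h]
      module
    rw [hPQ, smul_zero, add_zero] at hx
    have hQP : Q (P x) = 0 := by
      have h := congrArg Q hx
      simp only [map_sub, h2, map_zero] at h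
      rw [← neg_eq_zero, ← h]
      abel
    have hxx : x = Q x + P x := by
      rw [← sub_eq_zero, ← hx]
      abel
    rw [hxx]
    refine Submodule.add_mem_sup ?_ ?_
    · exact mem_jointSpace.mpr ⟨by simp [hPQ], by simp [h2]⟩
    · exact mem_jointSpace.mpr ⟨by simp [h1], by simp [hQP]⟩
  · refine sup_le ?_ ?_
    · rintro x ⟨ha, hb⟩
      simp only [Fin.val_zero, Fin.val_one, Nat.cast_zero, Nat.cast_one, zero_smul, one_smul]
        at ha hb
      change opX P Q x = 0
      rw [hX, hb, ha]
      module
    · rintro x ⟨ha, hb⟩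
      simp only [Fin.val_zero, Fin.val_one, Nat.cast_zero, Nat.cast_one, zero_smul, one_smul]
        at ha hb
      change opX P Q x = 0
      rw [hX, hb, ha, map_zero]
      module

variable [CompleteSpace H]

instance completeSpace_jointSpace (P Q : H →L[ℂ] H) (i j : Fin 2) : CompleteSpace (jointSpace P Q i j) :=
  (isClosed_jointSpace P Q i j).completeSpace_coe

theorem inner_eq_zero_of_eigen {P : H →L[ℂ] H} (hP : star P = P) {i k : Fin 2} (hik : i ≠ k)
    {x y : H} (hx : P x = (i.val : ℂ) • x) (hy : P y = (k.val : ℂ) • y) : ⟪x, y⟫_ℂ = 0 := by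
  have h : ⟪P x, y⟫_ℂ = ⟪x, P y⟫_ℂ := by
    rw [← ContinuousLinearMap.adjoint_inner_right, ← ContinuousLinearMap.star_eq_adjoint, hP]
  rw [hx, hy, inner_smul_left, inner_smul_right, Complex.conj_natCast] at h
  have hne : (i.val : ℂ) - k.val ≠ 0 := by
    rw [sub_ne_zero]
    exact_mod_cast fun h => hik (Fin.ext h)
  have : ((i.val : ℂ) - k.val) * ⟪x, y⟫_ℂ = 0 := by linear_combination h
  exact (mul_eq_zero.mp this).resolve_left hne

theorem inner_jointSpace_eq_zero {P Q : H →L[ℂ] H} (hP : star P = P) (hQ : star Q = Q)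
    {i j k l : Fin 2} (h : i ≠ k ∨ j ≠ l) {x y : H} (hx : x ∈ jointSpace P Q i j)
    (hy : y ∈ jointSpace P Q k l) : ⟪x, y⟫_ℂ = 0 := by
  rcases h with h | h
  · exact inner_eq_zero_of_eigen hP h hx.1 hy.1
  · exact inner_eq_zero_of_eigen hQ h hx.2 hy.2

/-- The domain of `V_can` is the orthogonal complement of `H_01 ⊕ H_10`. -/
theorem jointSpace_sup_perpSpace {P Q : H →L[ℂ] H} (hP : star P = P) (hQ : star Q = Q) :
    jointSpace P Q 0 0 ⊔ jointSpace P Q 1 1 ⊔ perpSpace P Q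
      = (jointSpace P Q 0 1 ⊔ jointSpace P Q 1 0)ᗮ := by
  have hperp : ∀ x, x ∈ perpSpace P Q ↔ ∀ i j, x ∈ (jointSpace P Q i j)ᗮ := by
    intro x
    simp only [perpSpace, Submodule.mem_iInf]
  have horth : ∀ {i j k l : Fin 2}, i ≠ k ∨ j ≠ l → ∀ x ∈ jointSpace P Q i j,
      x ∈ (jointSpace P Q k l)ᗮ := fun h x hx y hy => by
    rw [← inner_conj_symm, inner_jointSpace_eq_zero hP hQ h hx hy, map_zero]
  rw [← Submodule.inf_orthogonal]
  apply le_antisymm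
  · refine sup_le (sup_le ?_ ?_) ?_
    · exact fun x hx => ⟨horth (by simp) x hx, horth (by simp) x hx⟩
    · exact fun x hx => ⟨horth (by simp) x hx, horth (by simp) x hx⟩
    · exact fun x hx => ⟨(hperp x).mp hx 0 1, (hperp x).mp hx 1 0⟩
  · rintro x ⟨h01, h10⟩
    set a := (jointSpace P Q 0 0).starProjection x with ha
    set b := (jointSpace P Q 1 1).starProjection x with hb
    have hamem : a ∈ jointSpace P Q 0 0 := Submodule.starProjection_apply_mem _ _
    have hbmem : b ∈ jointSpace P Q 1 1 := Submodule.starProjection_apply_mem _ _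
    have hr : x - a - b ∈ perpSpace P Q := by
      rw [hperp]
      intro i j
      fin_cases i <;> fin_cases j
      · exact Submodule.sub_mem _ (Submodule.sub_starProjection_mem_orthogonal _)
          (horth (by simp) b hbmem)
      · exact Submodule.sub_mem _ (Submodule.sub_mem _ h01 (horth (by simp) a hamem))
          (horth (by simp) b hbmem)
      · exact Submodule.sub_mem _ (Submodule.sub_mem _ h10 (horth (by simp) a hamem))
          (horth (by simp) b hbmem)
      · have : x - a - b = (x - b) - a := by abel
        change x - a - b ∈ (jointSpace P Q 1 1)ᗮ
        rw [this]
        exact Submodule.sub_mem _ (Submodule.sub_starProjection_mem_orthogonal _)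
          (horth (by simp) a hamem)
    have hx : x = (a + b) + (x - a - b) := by abel
    rw [hx]
    exact Submodule.add_mem_sup (Submodule.add_mem_sup hamem hbmem) hr

theorem star_opX {P Q : H →L[ℂ] H} (hP : star P = P) (hQ : star Q = Q) :
    star (opX P Q) = 1 - P - Q + (2 : ℂ) • (Q * P) := by
  simp [opX, hP, hQ]

theorem star_opX_mul_opX {P Q : H →L[ℂ] H} (hP : star P = P) (hQ : star Q = Q) (hPP : P * P = P)
    (hQQ : Q * Q = Q) : star (opX P Q) * opX P Q = 1 - (P - Q) * (P - Q) := by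
  have h1 : ∀ x, P (P x) = P x := fun x => by rw [← mul_apply_eq_comp, hPP]
  have h2 : ∀ x, Q (Q x) = Q x := fun x => by rw [← mul_apply_eq_comp, hQQ]
  rw [star_opX hP hQ]
  ext x
  simp only [opX, mul_apply_eq_comp, add_apply, sub_apply, smul_apply, one_apply_eq_self, map_add,
    map_sub, map_smul, h1, h2]
  module

/-- Normality of `X`: exchanging `P` and `Q` exchanges `X` with `X*`, but leaves `1 - (P - Q)²`
alone. -/
theorem opX_mul_star_opX {P Q : H →L[ℂ] H} (hP : star P = P) (hQ : star Q = Q) (hPP : P * P = P)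
    (hQQ : Q * Q = Q) : opX P Q * star (opX P Q) = star (opX P Q) * opX P Q := by
  have h1 : ∀ x, P (P x) = P x := fun x => by rw [← mul_apply_eq_comp, hPP]
  have h2 : ∀ x, Q (Q x) = Q x := fun x => by rw [← mul_apply_eq_comp, hQQ]
  rw [star_opX_mul_opX hP hQ hPP hQQ, star_opX hP hQ]
  ext x
  simp only [opX, mul_apply_eq_comp, add_apply, sub_apply, smul_apply, one_apply_eq_self, map_add,
    map_sub, map_smul, h1, h2]
  module

/-- This identity is what makes the real part of `V_can` nonnegative. -/
theorem opX_add_star_opX {P Q : H →L[ℂ] H} (hP : star P = P) (hQ : star Q = Q) (hPP : P * P = P)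
    (hQQ : Q * Q = Q) :
    opX P Q + star (opX P Q) = (2 : ℂ) • (star (opX P Q) * opX P Q) := by
  rw [star_opX_mul_opX hP hQ hPP hQQ, star_opX hP hQ, opX, sub_mul, mul_sub, mul_sub, hPP, hQQ]
  module

/-- The polar decomposition of `X`: the factor `V_can` is `F X`, with `F` the inverse square root
of `X* X`. -/
theorem exists_vCan_factor {P Q : H →L[ℂ] H} (hP : star P = P) (hQ : star Q = Q) (hPP : P * P = P)
    (hQQ : Q * Q = Q) (hc : IsCompactOperator (P - Q : H →L[ℂ] H)) :
    ∃ F : H →L[ℂ] H, vCan P Q = F * opX P Q ∧ star F = F ∧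
      F * opX P Q = opX P Q * F ∧ F * star (opX P Q) = star (opX P Q) * F ∧
      (∀ x ∈ (opX P Q).kerᗮ, F (F (star (opX P Q) (opX P Q x))) = x) ∧
      0 ≤ F * (star (opX P Q) * opX P Q) ∧
      (∀ (σ : ℂ →+* ℂ) [RingHomInvPair σ σ] (e : H ≃ₛₗᵢ[σ] H), PreservesInner e →
        (∀ x, e ((star (opX P Q) * opX P Q) x) = (star (opX P Q) * opX P Q) (e x)) →
        ∀ x, e (F x) = F (e x)) := by
  set X := opX P Q with hX
  have hnorm : X * star X = star X * X := opX_mul_star_opX hP hQ hPP hQQ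
  set D := star X * X with hD
  have hD0 : 0 ≤ D := star_mul_self_nonneg X
  have hDsa : IsSelfAdjoint D := IsSelfAdjoint.of_nonneg hD0
  have hR : IsCompactOperator (1 * D - 1 : H →L[ℂ] H) := by
    have : (1 * D - 1 : H →L[ℂ] H) = -((P - Q) * (P - Q)) := by
      rw [one_mul, hD, star_opX_mul_opX hP hQ hPP hQQ]
      abel
    rw [this]
    exact (hc.comp_clm (P - Q)).neg
  obtain ⟨g, hg, hfg⟩ := exists_continuous_eqOn_inv_sqrt hD0 hR
  have hF : cfc (fun t : ℝ => (Real.sqrt t)⁻¹) D = cfc g D := cfc_congr hfg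
  have hXD : Commute D X := by
    rw [Commute, SemiconjBy, hD, mul_assoc, ← mul_assoc X, hnorm]
    exact (mul_assoc _ _ _).symm
  have hXD' : Commute D (star X) := by
    rw [Commute, SemiconjBy, hD, mul_assoc, hnorm]
  have hFD : cfc g D * D = cfc (fun t => g t * t) D := by
    conv_lhs => rw [← cfc_id' ℝ D]
    rw [cfc_id' ℝ D, cfc_mul g (fun t => t) D hg.continuousOn continuousOn_id, cfc_id' ℝ D]
  have hG : cfc g D * (cfc g D * D) = cfc (fun t => g t * (g t * t)) D := by
    rw [hFD, cfc_mul g (fun t => g t * t) D hg.continuousOn (hg.mul continuous_id).continuousOn]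
  -- The operator `F²D` has symbol `t g(t)²`, which is `1` on the nonzero spectrum and `0` at `0`:
  -- it is the projection onto the complement of the kernel.
  have hGD : D * (cfc g D * (cfc g D * D)) = D := by
    have h1 : D * cfc (fun t => g t * (g t * t)) D = cfc (fun t => t * (g t * (g t * t))) D := by
      rw [cfc_mul (fun t => t) (fun t => g t * (g t * t)) D continuousOn_id
        (hg.mul (hg.mul continuous_id)).continuousOn, cfc_id' ℝ D]
    rw [hG, h1]
    conv_rhs => rw [← cfc_id' ℝ D]
    apply cfc_congr
    intro t ht
    have ht0 := spectrum_nonneg_of_nonneg hD0 ht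
    beta_reduce
    rw [← hfg t ht]
    rcases eq_or_lt_of_le ht0 with h0 | h0
    · rw [← h0]
      simp
    · have hs := Real.sqrt_pos.mpr h0
      have hsq := Real.mul_self_sqrt ht0
      field_simp
      nlinarith
  have hGsa : star (cfc g D * (cfc g D * D)) = cfc g D * (cfc g D * D) := by
    rw [hG]
    exact cfc_predicate (p := IsSelfAdjoint) _ _
  refine ⟨cfc g D, by rw [vCan, ← hF], cfc_predicate (p := IsSelfAdjoint) _ _,
    (hDsa.commute_cfc hXD g).eq, (hDsa.commute_cfc hXD' g).eq, ?_, ?_, ?_⟩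
  · intro x hx
    change (cfc g D * (cfc g D * D)) x = x
    set G := cfc g D * (cfc g D * D) with hGdef
    have hGD' : G * D = D := by
      have := congrArg star hGD
      rwa [star_mul, hGsa, hDsa.star_eq] at this
    have hker : ∀ y, D y = 0 ↔ y ∈ X.ker := by
      intro y
      constructor
      · intro h
        have : ⟪X y, X y⟫_ℂ = 0 := by
          rw [← ContinuousLinearMap.adjoint_inner_left, ← ContinuousLinearMap.star_eq_adjoint,
            ← mul_apply_eq_comp, ← hD, h, inner_zero_left]
        exact inner_self_eq_zero.mp this
      · intro h
        have h : X y = 0 := h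
        rw [hD, mul_apply_eq_comp, h, map_zero]
    have h1 : G x - x ∈ X.ker := by
      rw [← hker, map_sub, ← mul_apply_eq_comp, hGD, sub_self]
    have h2 : G x ∈ X.kerᗮ := by
      intro y hy
      have hy0 : G y = 0 := by
        rw [hGdef, mul_apply_eq_comp, mul_apply_eq_comp, (hker y).mpr hy, map_zero, map_zero]
      rw [← hGsa, ContinuousLinearMap.star_eq_adjoint, ContinuousLinearMap.adjoint_inner_right, hy0,
        inner_zero_left]
    have h3 := Submodule.sub_mem _ h2 hx
    exact sub_eq_zero.mp (inner_self_eq_zero.mp (h3 _ h1))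
  · rw [hFD]
    refine cfc_nonneg fun t ht => ?_
    rw [← hfg t ht]
    exact mul_nonneg (inv_nonneg.mpr (Real.sqrt_nonneg _)) (spectrum_nonneg_of_nonneg hD0 ht)
  · intro σ _ e he heD x
    exact map_cfc_of_commute e he hDsa heD hg x

end ProjectionPair

/-! ### Action of the symmetries on the spaces attached to the pair. -/

section Satisfies

variable {E : Type*} [NormedAddCommGroup E] [InnerProductSpace ℂ E] {S : SymType}

theorem SymRep.satisfies_of_comm (ρ : SymRep S E) (U : E ≃ₗᵢ[ℂ] E)
    (h1 : ∀ h φ, ρ.eta h (U φ) = U (ρ.eta h φ)) (h2 : ∀ h φ, U (ρ.tau h (U φ)) = ρ.tau h φ)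
    (h3 : ∀ h φ, U (ρ.gamma h (U φ)) = ρ.gamma h φ) : ρ.Satisfies U := by
  refine ⟨fun h φ => ?_, fun h φ => ?_, fun h φ => ?_⟩
  · rw [h1, LinearIsometryEquiv.apply_symm_apply]
  · apply U.injective
    rw [h2, LinearIsometryEquiv.apply_symm_apply, LinearIsometryEquiv.apply_symm_apply]
  · apply U.injective
    rw [h3, LinearIsometryEquiv.apply_symm_apply, LinearIsometryEquiv.apply_symm_apply]

theorem SymRep.Invariant.sup {ρ : SymRep S E} {K L : Submodule ℂ E} (hK : ρ.Invariant K)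
    (hL : ρ.Invariant L) : ρ.Invariant (K ⊔ L) := by
  have key : ∀ f : E → E, (∀ x y, f (x + y) = f x + f y) → (∀ x ∈ K, f x ∈ K) →
      (∀ x ∈ L, f x ∈ L) → ∀ x ∈ K ⊔ L, f x ∈ K ⊔ L := by
    intro f hf h1 h2 x hx
    obtain ⟨a, ha, b, hb, rfl⟩ := Submodule.mem_sup.mp hx
    rw [hf]
    exact Submodule.add_mem_sup (h1 a ha) (h2 b hb)
  exact ⟨fun h => key _ (map_add _) (hK.1 h) (hL.1 h),
    fun h => key _ (map_add _) (hK.2.1 h) (hL.2.1 h),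
    fun h => key _ (map_add _) (hK.2.2 h) (hL.2.2 h)⟩

end Satisfies

section JointSpaceMap

variable {H : Type*} [NormedAddCommGroup H] [InnerProductSpace ℂ H]

theorem jointSpace_comm (P Q : H →L[ℂ] H) (i j : Fin 2) :
    jointSpace Q P i j = jointSpace P Q j i := by
  ext x
  exact and_comm

theorem perpSpace_comm (P Q : H →L[ℂ] H) : perpSpace Q P = perpSpace P Q := by
  simp only [perpSpace, jointSpace_comm P Q]
  exact iInf_comm

variable {σ : ℂ →+* ℂ} [RingHomInvPair σ σ]

/-- The eigenvalues `0` and `1` are fixed by `σ`, so antilinear maps are covered too. A symmetry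
that exchanges the projections is the case `P' = Q`, `Q' = P`. -/
theorem map_jointSpace {P Q P' Q' : H →L[ℂ] H} (e : H ≃ₛₗᵢ[σ] H) (hP : ∀ x, e (P x) = P' (e x))
    (hQ : ∀ x, e (Q x) = Q' (e x)) (i j : Fin 2) :
    (jointSpace P Q i j).map (e.toLinearEquiv : H →ₛₗ[σ] H) = jointSpace P' Q' i j := by
  have key : ∀ x, x ∈ jointSpace P Q i j ↔ e x ∈ jointSpace P' Q' i j := by
    intro x
    rw [mem_jointSpace, mem_jointSpace, ← hP, ← hQ]
    have h : ∀ n : ℕ, (n : ℂ) • e x = e ((n : ℂ) • x) := fun n => by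
      rw [map_smulₛₗ, map_natCast]
    rw [h, h, e.injective.eq_iff, e.injective.eq_iff]
  ext y
  constructor
  · rintro ⟨x, hx, rfl⟩
    exact (key x).mp hx
  · intro hy
    exact ⟨e.symm y, (key _).mpr (by rwa [e.apply_symm_apply]), e.apply_symm_apply y⟩

theorem map_mem_orthogonal {e : H ≃ₛₗᵢ[σ] H} (he : PreservesInner e) {N : Submodule ℂ H} {x : H}
    (hx : x ∈ Nᗮ) : e x ∈ (N.map (e.toLinearEquiv : H →ₛₗ[σ] H))ᗮ := by
  rintro _ ⟨y, hy, rfl⟩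
  have := he y x 0 0 (by rw [hx y hy, inner_zero_left])
  rw [map_zero, inner_zero_left] at this
  exact this

theorem map_mem_perpSpace {P Q P' Q' : H →L[ℂ] H} {e : H ≃ₛₗᵢ[σ] H} (he : PreservesInner e)
    (hP : ∀ x, e (P x) = P' (e x)) (hQ : ∀ x, e (Q x) = Q' (e x)) {x : H}
    (hx : x ∈ perpSpace P Q) : e x ∈ perpSpace P' Q' := by
  simp only [perpSpace, Submodule.mem_iInf] at hx ⊢
  intro i j
  rw [← map_jointSpace e hP hQ]
  exact map_mem_orthogonal he (hx i j)

end JointSpaceMap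

section ActsOnPair

variable {H : Type*} [NormedAddCommGroup H] [InnerProductSpace ℂ H] {S : SymType}

/-- The symmetries `η` commute with `P` and `Q`, while `τ` and `γ` exchange them. -/
structure SymRep.ActsOnPair (ρ : SymRep S H) (P Q : H →L[ℂ] H) : Prop where
  eta_fst : ∀ h x, ρ.eta h (P x) = P (ρ.eta h x)
  eta_snd : ∀ h x, ρ.eta h (Q x) = Q (ρ.eta h x)
  tau_fst : ∀ h x, ρ.tau h (P x) = Q (ρ.tau h x)
  tau_snd : ∀ h x, ρ.tau h (Q x) = P (ρ.tau h x)
  gamma_fst : ∀ h x, ρ.gamma h (P x) = Q (ρ.gamma h x)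
  gamma_snd : ∀ h x, ρ.gamma h (Q x) = P (ρ.gamma h x)

namespace SymRep.ActsOnPair

variable {ρ : SymRep S H} {P Q : H →L[ℂ] H}

theorem map_eta (hρ : ρ.ActsOnPair P Q) (h : S.HasEta) (i j : Fin 2) :
    (jointSpace P Q i j).map ((ρ.eta h).toLinearEquiv : H →ₗ⋆[ℂ] H) = jointSpace P Q i j :=
  map_jointSpace _ (hρ.eta_fst h) (hρ.eta_snd h) i j

theorem map_tau (hρ : ρ.ActsOnPair P Q) (h : S.HasTau) (i j : Fin 2) :
    (jointSpace P Q i j).map ((ρ.tau h).toLinearEquiv : H →ₗ⋆[ℂ] H) = jointSpace P Q j i :=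
  (map_jointSpace _ (hρ.tau_fst h) (hρ.tau_snd h) i j).trans (jointSpace_comm P Q i j)

theorem map_gamma (hρ : ρ.ActsOnPair P Q) (h : S.HasGamma) (i j : Fin 2) :
    (jointSpace P Q i j).map ((ρ.gamma h).toLinearEquiv : H →ₗ[ℂ] H) = jointSpace P Q j i :=
  (map_jointSpace _ (hρ.gamma_fst h) (hρ.gamma_snd h) i j).trans (jointSpace_comm P Q i j)

theorem eta_mem (hρ : ρ.ActsOnPair P Q) (h : S.HasEta) {i j : Fin 2} {x : H}
    (hx : x ∈ jointSpace P Q i j) : ρ.eta h x ∈ jointSpace P Q i j :=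
  (hρ.map_eta h i j).le ⟨x, hx, rfl⟩

theorem tau_mem (hρ : ρ.ActsOnPair P Q) (h : S.HasTau) {i j : Fin 2} {x : H}
    (hx : x ∈ jointSpace P Q i j) : ρ.tau h x ∈ jointSpace P Q j i :=
  (hρ.map_tau h i j).le ⟨x, hx, rfl⟩

theorem gamma_mem (hρ : ρ.ActsOnPair P Q) (h : S.HasGamma) {i j : Fin 2} {x : H}
    (hx : x ∈ jointSpace P Q i j) : ρ.gamma h x ∈ jointSpace P Q j i :=
  (hρ.map_gamma h i j).le ⟨x, hx, rfl⟩

theorem invariant_diag (hρ : ρ.ActsOnPair P Q) (i : Fin 2) : ρ.Invariant (jointSpace P Q i i) :=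
  ⟨fun h _ => hρ.eta_mem h, fun h _ => hρ.tau_mem h, fun h _ => hρ.gamma_mem h⟩

theorem invariant_offDiag (hρ : ρ.ActsOnPair P Q) :
    ρ.Invariant (jointSpace P Q 0 1 ⊔ jointSpace P Q 1 0) := by
  refine ⟨fun h x hx => ?_, fun h x hx => ?_, fun h x hx => ?_⟩ <;>
    obtain ⟨a, ha, b, hb, rfl⟩ := Submodule.mem_sup.mp hx
  · rw [map_add]
    exact Submodule.add_mem_sup (hρ.eta_mem h ha) (hρ.eta_mem h hb)
  · rw [map_add, add_comm]
    exact Submodule.add_mem_sup (hρ.tau_mem h hb) (hρ.tau_mem h ha)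
  · rw [map_add, add_comm]
    exact Submodule.add_mem_sup (hρ.gamma_mem h hb) (hρ.gamma_mem h ha)

theorem invariant_perpSpace (hρ : ρ.ActsOnPair P Q) : ρ.Invariant (perpSpace P Q) := by
  refine ⟨fun h x hx => ?_, fun h x hx => ?_, fun h x hx => ?_⟩
  · exact map_mem_perpSpace (preservesInner_of_antiunitary _) (hρ.eta_fst h) (hρ.eta_snd h) hx
  · rw [← perpSpace_comm]
    exact map_mem_perpSpace (preservesInner_of_antiunitary _) (hρ.tau_fst h) (hρ.tau_snd h) hx
  · rw [← perpSpace_comm]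
    exact map_mem_perpSpace (preservesInner_of_unitary _) (hρ.gamma_fst h) (hρ.gamma_snd h) hx

theorem invariant_decoupled (hρ : ρ.ActsOnPair P Q) :
    ρ.Invariant (jointSpace P Q 0 0 ⊔ jointSpace P Q 1 1 ⊔ perpSpace P Q) :=
  ((hρ.invariant_diag 0).sup (hρ.invariant_diag 1)).sup hρ.invariant_perpSpace

end SymRep.ActsOnPair

end ActsOnPair

/-! ### The canonical decoupling operator. -/

section Decoupling

variable {H : Type*} [NormedAddCommGroup H] [InnerProductSpace ℂ H] [CompleteSpace H]

/-- A unitary with nonnegative real part has an essential gap, and no eigenvalue, at `-1`. -/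
theorem essGapAt_neg_one_of_re_nonneg {E : Type*} [NormedAddCommGroup E] [InnerProductSpace ℂ E]
    [CompleteSpace E] {T : E →L[ℂ] E} (h : ∀ x, 0 ≤ (⟪T x, x⟫_ℂ).re) :
    EssGapAt T (-1) ∧ ¬ Module.End.HasEigenvalue T.toLinearMap (-1) := by
  have hu : IsUnit (T - (-1 : ℂ) • (1 : E →L[ℂ] E)) := by
    -- The real part of `⟪(T + 1) x, x⟫` is at least `‖x‖²`, so `T + 1` is coercive with constant
    -- `1`.
    apply ContinuousLinearMap.isUnit_of_forall_le_norm_inner_map (c := 1) _ one_pos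
    intro x
    have e : (T - (-1 : ℂ) • (1 : E →L[ℂ] E)) x = T x + x := by
      simp
    rw [e, NNReal.coe_one, mul_one, inner_add_left]
    refine le_trans ?_ (Complex.re_le_norm _)
    rw [Complex.add_re, ← inner_self_eq_norm_sq (𝕜 := ℂ)]
    have := h x
    change (⟪x, x⟫_ℂ).re ≤ _
    linarith
  obtain ⟨u, hu⟩ := hu
  constructor
  · refine ⟨(u⁻¹ : (E →L[ℂ] E)ˣ), ?_, ?_⟩
    · rw [← hu, Units.mul_inv, sub_self]
      exact isCompactOperator_zero
    · rw [← hu, Units.inv_mul, sub_self]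
      exact isCompactOperator_zero
  · intro hev
    obtain ⟨x, hx⟩ := hev.exists_hasEigenvector
    apply hx.2
    have h1 : T x = (-1 : ℂ) • x := hx.apply_eq_smul
    have h2 : (u : E →L[ℂ] E) x = 0 := by
      rw [hu]
      simp [h1]
    have h3 := congrArg (u⁻¹ : (E →L[ℂ] E)ˣ).val h2
    rwa [← mul_apply_eq_comp, Units.inv_mul, one_apply_eq_self, map_zero] at h3

/-- The canonical decoupling operator is a unitary on `H_00 ⊕ H_11 ⊕ H_⊥` which satisfies the
commutation relations and is gapped at `-1`. -/
theorem exists_decoupling {S : SymType} {ρ : SymRep S H} {P Q : H →L[ℂ] H}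
    (hρ : ρ.ActsOnPair P Q) (hP : star P = P) (hQ : star Q = Q) (hPP : P * P = P)
    (hQQ : Q * Q = Q) (hc : IsCompactOperator (P - Q : H →L[ℂ] H)) (K : Submodule ℂ H)
    (hK : ρ.Invariant K) (hKX : K = (opX P Q).kerᗮ) :
    ∃ V : K ≃ₗᵢ[ℂ] K, (∀ φ, (V φ : H) = vCan P Q (φ : H)) ∧ (ρ.restrict K hK).Satisfies V ∧
      EssGapAt (unitaryOp V) (-1) ∧
      ¬ Module.End.HasEigenvalue (unitaryOp V).toLinearMap (-1) := by
  have hcomp : CompleteSpace K := by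
    subst hKX
    infer_instance
  obtain ⟨F, hV, hF, hFX, hFX', hFFD, hpos, hcomm⟩ := exists_vCan_factor hP hQ hPP hQQ hc
  have hnorm := opX_mul_star_opX hP hQ hPP hQQ
  have hadd := opX_add_star_opX hP hQ hPP hQQ
  have hXapp : ∀ x, opX P Q x = x - P x - Q x + (2 : ℂ) • P (Q x) := fun x => rfl
  have hX'app : ∀ x, star (opX P Q) x = x - P x - Q x + (2 : ℂ) • Q (P x) := fun x => by
    rw [star_opX hP hQ]
    rfl
  set X := opX P Q with hX
  have hFXa : ∀ x, F (X x) = X (F x) := fun x => congrArg (fun z : H →L[ℂ] H => z x) hFX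
  have hFXa' : ∀ x, F (star X x) = star X (F x) :=
    fun x => congrArg (fun z : H →L[ℂ] H => z x) hFX'
  have hnorma : ∀ x, X (star X x) = star X (X x) :=
    fun x => congrArg (fun z : H →L[ℂ] H => z x) hnorm
  have hker : ∀ y, X y = 0 → star X y = 0 := by
    intro y hy
    rw [← inner_self_eq_zero (𝕜 := ℂ), ContinuousLinearMap.star_eq_adjoint,
      ContinuousLinearMap.adjoint_inner_left, ← ContinuousLinearMap.star_eq_adjoint, hnorma, hy,
      map_zero, inner_zero_right]
  have hXK : ∀ x, X x ∈ K := by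
    intro x
    rw [hKX]
    intro y hy
    rw [← ContinuousLinearMap.adjoint_inner_left, ← ContinuousLinearMap.star_eq_adjoint, hker y hy,
      inner_zero_left]
  have hXK' : ∀ x, star X x ∈ K := by
    intro x
    rw [hKX]
    intro y hy
    have hy : X y = 0 := hy
    rw [ContinuousLinearMap.star_eq_adjoint, ContinuousLinearMap.adjoint_inner_right, hy,
      inner_zero_left]
  have hFFD' : ∀ x ∈ K, F (X (F (star X x))) = x := by
    intro x hx
    rw [← hFXa, hnorma]
    exact hFFD x (hKX ▸ hx)
  have hFFD'' : ∀ x ∈ K, F (star X (F (X x))) = x := by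
    intro x hx
    rw [← hFXa']
    exact hFFD x (hKX ▸ hx)
  let f : K →ₗ[ℂ] K := (F * X).toLinearMap.restrict fun x _ => by
    change F (X x) ∈ K
    rw [hFXa]
    exact hXK _
  let g : K →ₗ[ℂ] K := (F * star X).toLinearMap.restrict fun x _ => by
    change F (star X x) ∈ K
    rw [hFXa']
    exact hXK' _
  have hf : ∀ x, (f x : H) = F (X x) := fun x => rfl
  have hg : ∀ x, (g x : H) = F (star X x) := fun x => rfl
  have hiso : ∀ x : K, ‖f x‖ = ‖x‖ := by
    intro x
    have h1 : ⟪F (X (x : H)), F (X (x : H))⟫_ℂ = ⟪(x : H), x⟫_ℂ := by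
      conv_lhs => rw [← hF]
      rw [ContinuousLinearMap.star_eq_adjoint, ContinuousLinearMap.adjoint_inner_left,
        ← ContinuousLinearMap.star_eq_adjoint, hF, ← ContinuousLinearMap.adjoint_inner_right,
        ← ContinuousLinearMap.star_eq_adjoint, ← hFXa', hFFD'' x x.2]
    have h2 : ‖(f x : H)‖ ^ 2 = ‖(x : H)‖ ^ 2 := by
      rw [← inner_self_eq_norm_sq (𝕜 := ℂ), ← inner_self_eq_norm_sq (𝕜 := ℂ), hf, h1]
    exact (sq_eq_sq₀ (norm_nonneg _) (norm_nonneg _)).mp h2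
  -- The inverse is the compression of `F X*`: `F` commutes with `X` and `X*`, and `F² X* X` is the
  -- identity on `K`.
  let V : K ≃ₗᵢ[ℂ] K :=
    { toLinearEquiv := LinearEquiv.ofLinearMap f g
        (LinearMap.ext fun x => Subtype.ext (hFFD' x x.2))
        (LinearMap.ext fun x => Subtype.ext (hFFD'' x x.2))
      norm_map' := hiso }
  have hVa : ∀ x : K, (V x : H) = F (X x) := fun x => rfl
  refine ⟨V, fun φ => by rw [hV]; rfl, ?_, essGapAt_neg_one_of_re_nonneg fun x => ?_⟩
  -- An `e` exchanging `P` and `Q` turns `X` into `X*` and, by normality, commutes with `D` and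
  -- hence with `F`. So `V e V = V V* e = e` on `K`.
  · have swap : ∀ (σ : ℂ →+* ℂ) [RingHomInvPair σ σ] (e : H ≃ₛₗᵢ[σ] H), PreservesInner e →
        (∀ x, e (P x) = Q (e x)) → (∀ x, e (Q x) = P (e x)) → (∀ x ∈ K, e x ∈ K) →
        ∀ x ∈ K, F (X (e (F (X x)))) = e x := by
      intro σ _ e he heP heQ heK x hx
      have h2 : ∀ y, e ((2 : ℂ) • y) = (2 : ℂ) • e y := fun y => by
        rw [map_smulₛₗ, map_ofNat]
      have heX : ∀ y, e (X y) = star X (e y) := by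
        intro y
        rw [hXapp, hX'app, map_add, map_sub, map_sub, h2, heP, heQ, heP, heQ]
        abel
      have heX' : ∀ y, e (star X y) = X (e y) := by
        intro y
        rw [hXapp, hX'app, map_add, map_sub, map_sub, h2, heP, heQ, heQ, heP]
        abel
      rw [hcomm σ e he (fun y => by
        rw [mul_apply_eq_comp, mul_apply_eq_comp, heX', heX, hnorma]), heX]
      exact hFFD' _ (heK x hx)
    refine SymRep.satisfies_of_comm _ _ (fun h x => Subtype.ext ?_) (fun h x => Subtype.ext ?_)
      (fun h x => Subtype.ext ?_)
    · change ρ.eta h (F (X x)) = F (X (ρ.eta h x))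
      have h2 : ∀ y, ρ.eta h ((2 : ℂ) • y) = (2 : ℂ) • ρ.eta h y := fun y => by
        rw [map_smulₛₗ, map_ofNat]
      have heX : ∀ y, ρ.eta h (X y) = X (ρ.eta h y) := by
        intro y
        simp only [hXapp, map_add, map_sub, h2, hρ.eta_fst, hρ.eta_snd]
      have heX' : ∀ y, ρ.eta h (star X y) = star X (ρ.eta h y) := by
        intro y
        simp only [hX'app, map_add, map_sub, h2, hρ.eta_fst, hρ.eta_snd]
      rw [hcomm _ (ρ.eta h) (preservesInner_of_antiunitary _) (fun y => by
        rw [mul_apply_eq_comp, mul_apply_eq_comp, heX', heX]), heX]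
    · exact swap _ (ρ.tau h) (preservesInner_of_antiunitary _) (hρ.tau_fst h) (hρ.tau_snd h)
        (hK.2.1 h) x x.2
    · exact swap _ (ρ.gamma h) (preservesInner_of_unitary _) (hρ.gamma_fst h) (hρ.gamma_snd h)
        (hK.2.2 h) x x.2
  · change 0 ≤ (⟪F (X (x : H)), (x : H)⟫_ℂ).re
    have h1 := ((ContinuousLinearMap.nonneg_iff_isPositive _).mp hpos).re_inner_nonneg_left (x : H)
    have h2 : ⟪F (star X (x : H)), (x : H)⟫_ℂ = ⟪(x : H), F (X (x : H))⟫_ℂ := by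
      conv_lhs => rw [← hF]
      rw [ContinuousLinearMap.star_eq_adjoint, ContinuousLinearMap.adjoint_inner_left,
        ContinuousLinearMap.star_eq_adjoint, ContinuousLinearMap.adjoint_inner_left, ← hFXa]
    -- The two summands are complex conjugates, so twice the real part equals `2⟪F D x, x⟫`, which
    -- is nonnegative.
    have h3 : ⟪F (X (x : H)), (x : H)⟫_ℂ + ⟪F (star X (x : H)), (x : H)⟫_ℂ
        = 2 * ⟪(F * (star X * X)) (x : H), (x : H)⟫_ℂ := by
      rw [← inner_add_left, ← map_add, ← add_apply, hadd, smul_apply, map_smul, inner_smul_left,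
        map_ofNat]
      rfl
    rw [h2, ← inner_conj_symm (x : H)] at h3
    have h4 := congrArg Complex.re h3
    rw [Complex.add_re, Complex.conj_re, Complex.mul_re] at h4
    simp only [Complex.re_ofNat, Complex.im_ofNat, zero_mul, sub_zero] at h4
    change 0 ≤ (⟪(F * (star X * X)) (x : H), (x : H)⟫_ℂ).re at h1
    linarith

end Decoupling

/-! ### Balancedness on `H_01 ⊕ H_10`, type by type. -/

section Balanced

variable {H : Type*} [NormedAddCommGroup H] [InnerProductSpace ℂ H] {S : SymType}

/-- An isometric complex structure with the right commutation relations witnesses balancedness. -/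
theorem SymRep.balanced_restrict (ρ : SymRep S H) (L : Submodule ℂ H) (hL : ρ.Invariant L)
    (U : H →ₗ[ℂ] H) (hUL : ∀ x ∈ L, U x ∈ L) (hUU : ∀ x ∈ L, U (U x) = -x)
    (hU : ∀ x ∈ L, ‖U x‖ = ‖x‖) (h1 : ∀ h, ∀ x ∈ L, ρ.eta h (U x) = U (ρ.eta h x))
    (h2 : ∀ h, ∀ x ∈ L, ρ.tau h (U x) = -U (ρ.tau h x))
    (h3 : ∀ h, ∀ x ∈ L, ρ.gamma h (U x) = -U (ρ.gamma h x)) : (ρ.restrict L hL).Balanced := by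
  let f : L →ₗ[ℂ] L := U.restrict hUL
  have hff : ∀ x, f (f x) = -x := fun x => Subtype.ext (hUU x x.2)
  let V : L ≃ₗᵢ[ℂ] L :=
    { toLinearEquiv := LinearEquiv.ofLinearMap f (-f)
        (LinearMap.ext fun x => by simp [hff]) (LinearMap.ext fun x => by simp [hff])
      norm_map' := fun x => hU x x.2 }
  have hspec : ∀ z : ℂ, z * z = 1 → z ∉ spectrum ℂ (unitaryOp V) := by
    intro z hz
    rw [spectrum.notMem_iff, Algebra.algebraMap_eq_smul_one]
    have hVV : unitaryOp V * unitaryOp V = -1 := by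
      ext x
      exact congrArg Subtype.val (hff x)
    -- From `z² = 1` and `V² = -1` one gets `(z - V)(z + V) = 2`.
    refine ⟨⟨z • 1 - unitaryOp V, (1 / 2 : ℂ) • (z • 1 + unitaryOp V), ?_, ?_⟩, rfl⟩
    · rw [mul_smul_comm, sub_mul, mul_add, mul_add, hVV, smul_mul_smul_comm, hz, smul_mul_assoc,
        mul_smul_comm, one_mul, mul_one, one_mul]
      module
    · rw [smul_mul_assoc, mul_sub, add_mul, add_mul, hVV, smul_mul_smul_comm, hz, smul_mul_assoc,
        mul_smul_comm, one_mul, mul_one, one_mul]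
      module
  refine ⟨V, SymRep.satisfies_of_comm _ _ (fun h x => Subtype.ext (h1 h x x.2))
    (fun h x => Subtype.ext ?_) (fun h x => Subtype.ext ?_), hspec 1 (by norm_num),
    hspec (-1) (by norm_num)⟩
  · change U (ρ.tau h (U x)) = ρ.tau h x
    rw [h2 h x x.2, map_neg, hUU _ (hL.2.1 h x x.2), neg_neg]
  · change U (ρ.gamma h (U x)) = ρ.gamma h x
    rw [h3 h x x.2, map_neg, hUU _ (hL.2.2 h x x.2), neg_neg]

theorem norm_eq_of_skew {U : H →ₗ[ℂ] H} (hU : ∀ x y, ⟪U x, y⟫_ℂ = -⟪x, U y⟫_ℂ) {x : H}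
    (hx : U (U x) = -x) : ‖U x‖ = ‖x‖ := by
  have h : ⟪U x, U x⟫_ℂ = ⟪x, x⟫_ℂ := by rw [hU, hx, inner_neg_right, neg_neg]
  have h2 : ‖U x‖ ^ 2 = ‖x‖ ^ 2 := by
    rw [← inner_self_eq_norm_sq (𝕜 := ℂ), ← inner_self_eq_norm_sq (𝕜 := ℂ), h]
  exact (sq_eq_sq₀ (norm_nonneg _) (norm_nonneg _)).mp h2

/-- The relation for `τ` follows from those for `η` and `γ = η τ`. -/
theorem SymRep.tau_anticomm (ρ : SymRep S H) (h₁ : S.HasEta) (h₂ : S.HasTau) (h₃ : S.HasGamma)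
    {U : H →ₗ[ℂ] H} {x : H} (hη : ρ.eta h₁ (U (ρ.tau h₂ x)) = U (ρ.eta h₁ (ρ.tau h₂ x)))
    (hγ : ρ.gamma h₃ (U x) = -U (ρ.gamma h₃ x)) : ρ.tau h₂ (U x) = -U (ρ.tau h₂ x) := by
  apply (ρ.eta h₁).injective
  rw [ρ.eta_tau h₁ h₂ h₃, hγ, map_neg, hη, ρ.eta_tau h₁ h₂ h₃]

/-- Without `η` and `γ`, every representation is balanced. -/
theorem SymRep.balanced_of_not_eta_gamma (ρ : SymRep S H) (L : Submodule ℂ H) (hL : ρ.Invariant L)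
    (h1 : ¬ S.HasEta) (h3 : ¬ S.HasGamma) : (ρ.restrict L hL).Balanced := by
  have hU : ∀ x : H, (Complex.I • (LinearMap.id : H →ₗ[ℂ] H)) x = Complex.I • x := fun x => rfl
  refine ρ.balanced_restrict L hL (Complex.I • LinearMap.id) (fun x hx => L.smul_mem _ hx)
    (fun x _ => ?_) (fun x _ => ?_) (fun h => absurd h h1) (fun h x _ => ?_)
    (fun h => absurd h h3)
  · rw [hU, hU, smul_smul, Complex.I_mul_I, neg_one_smul]
  · rw [hU, norm_smul, Complex.norm_I, one_mul]
  · rw [hU, hU, map_smulₛₗ, Complex.conj_I, neg_smul]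

/-- Only `η` present: an `η`-invariant space of even dimension, or with `η² = -1`, is balanced. -/
theorem SymRep.balanced_of_not_tau_gamma (ρ : SymRep S H) (L : Submodule ℂ H)
    [FiniteDimensional ℂ L] (hL : ρ.Invariant L) (h1 : S.HasEta) (h2 : ¬ S.HasTau)
    (h3 : ¬ S.HasGamma)
    (hsq : (S.etaSq.get h1 = 1 ∧ Even (Module.finrank ℂ L)) ∨ S.etaSq.get h1 = -1) :
    (ρ.restrict L hL).Balanced := by
  obtain ⟨B, hB1, hB2, hB3, hB4⟩ := exists_skew_complexStructure
    (η := ((ρ.eta h1).toLinearEquiv : H →ₗ⋆[ℂ] H)) (inner_map_map_of_antiunitary (ρ.eta h1)) _ L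
    rfl (hL.1 h1) (by
      rcases hsq with ⟨h, he⟩ | h
      · exact Or.inl ⟨fun x => (ρ.eta_sq h1 x).trans (by rw [h, one_smul]), he⟩
      · exact Or.inr fun x => (ρ.eta_sq h1 x).trans (by rw [h, neg_one_smul]))
  exact ρ.balanced_restrict L hL B (fun x _ => hB2 x) hB3
    (fun x hx => norm_eq_of_skew hB1 (hB3 x hx)) (fun h x _ => (hB4 x).symm)
    (fun h => absurd h h2) (fun h => absurd h h3)

namespace SymRep.ActsOnPair

variable [CompleteSpace H] {ρ : SymRep S H} {P Q : H →L[ℂ] H}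

/-- The grading of `H_01 ⊕ H_10`. -/
theorem exists_grading (hP : star P = P) (hQ : star Q = Q) :
    ∃ A : H →ₗ[ℂ] H, (∀ a ∈ jointSpace P Q 0 1, ∀ b ∈ jointSpace P Q 1 0, A (a + b) = a - b) ∧
      ∀ a ∈ jointSpace P Q 0 1, ∀ b ∈ jointSpace P Q 1 0, ‖a - b‖ = ‖a + b‖ := by
  refine ⟨((jointSpace P Q 0 1).starProjection - (jointSpace P Q 1 0).starProjection).toLinearMap,
    fun a ha b hb => ?_, fun a ha b hb => ?_⟩
  · have h1 : (jointSpace P Q 1 0).starProjection a = 0 := by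
      rw [Submodule.starProjection_apply_eq_zero_iff]
      exact fun y hy => inner_jointSpace_eq_zero hP hQ (by simp) hy ha
    have h2 : (jointSpace P Q 0 1).starProjection b = 0 := by
      rw [Submodule.starProjection_apply_eq_zero_iff]
      exact fun y hy => inner_jointSpace_eq_zero hP hQ (by simp) hy hb
    change (jointSpace P Q 0 1).starProjection (a + b) - (jointSpace P Q 1 0).starProjection (a + b)
      = a - b
    rw [map_add, map_add, h1, h2, Submodule.starProjection_eq_self_iff.mpr ha,
      Submodule.starProjection_eq_self_iff.mpr hb, add_zero, zero_add]
  · have h : ⟪a, b⟫_ℂ = 0 := inner_jointSpace_eq_zero hP hQ (by simp) ha hb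
    have h2 : ‖a - b‖ * ‖a - b‖ = ‖a + b‖ * ‖a + b‖ := by
      rw [norm_sub_mul_self (𝕜 := ℂ), norm_add_mul_self (𝕜 := ℂ), h]
      simp
    exact (mul_self_inj (norm_nonneg _) (norm_nonneg _)).mp h2

/-- Only `γ` present. -/
theorem balanced_of_not_eta_tau (hρ : ρ.ActsOnPair P Q) (hP : star P = P) (hQ : star Q = Q)
    (h1 : ¬ S.HasEta) (h2 : ¬ S.HasTau) : (ρ.restrict _ hρ.invariant_offDiag).Balanced := by
  obtain ⟨A, hA, hAn⟩ := exists_grading (P := P) (Q := Q) hP hQ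
  have hU : ∀ x, (Complex.I • A) x = Complex.I • A x := fun x => rfl
  -- `γ` exchanges the two summands and so anticommutes with the grading; the factor `i` makes the
  -- square `-1`.
  refine ρ.balanced_restrict _ _ (Complex.I • A) (fun x hx => ?_) (fun x hx => ?_)
    (fun x hx => ?_) (fun h => absurd h h1) (fun h => absurd h h2) (fun h x hx => ?_) <;>
    obtain ⟨a, ha, b, hb, rfl⟩ := Submodule.mem_sup.mp hx
  · rw [hU, hA a ha b hb, sub_eq_add_neg]
    exact Submodule.smul_mem _ _ (Submodule.add_mem_sup ha (Submodule.neg_mem _ hb))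
  · rw [hU, hU, map_smul, hA a ha b hb, sub_eq_add_neg, hA a ha _ (Submodule.neg_mem _ hb),
      smul_smul, Complex.I_mul_I, neg_one_smul, sub_neg_eq_add]
  · rw [hU, hA a ha b hb, norm_smul, Complex.norm_I, one_mul, hAn a ha b hb]
  · rw [hU, hU, hA a ha b hb, map_smul, map_sub, map_add, add_comm (ρ.gamma h a),
      hA _ (hρ.gamma_mem h hb) _ (hρ.gamma_mem h ha), ← smul_neg, neg_sub]

/-- All symmetries present, with `γ² = 1`. -/
theorem balanced_of_gammaSq_eq_one (hρ : ρ.ActsOnPair P Q) (hP : star P = P) (hQ : star Q = Q)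
    (h1 : S.HasEta) (h3 : S.HasGamma) (hsq : S.gammaSq.get h3 = 1) :
    (ρ.restrict _ hρ.invariant_offDiag).Balanced := by
  obtain ⟨A, hA, hAn⟩ := exists_grading (P := P) (Q := Q) hP hQ
  -- As `γ` anticommutes with the grading, `U² = -γ²A² = -1`; no parity condition is needed here.
  let U : H →ₗ[ℂ] H := (ρ.gamma h3).toLinearEquiv.toLinearMap ∘ₗ A
  have hU : ∀ x, U x = ρ.gamma h3 (A x) := fun x => rfl
  have hgg : ∀ x, ρ.gamma h3 (ρ.gamma h3 x) = x := fun x => by rw [ρ.gamma_sq, hsq, one_smul]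
  have hL := hρ.invariant_offDiag
  have hη : ∀ h, ∀ x ∈ jointSpace P Q 0 1 ⊔ jointSpace P Q 1 0,
      ρ.eta h (U x) = U (ρ.eta h x) := by
    intro h x hx
    obtain ⟨a, ha, b, hb, rfl⟩ := Submodule.mem_sup.mp hx
    rw [hU, hU, hA a ha b hb, map_add (ρ.eta h), hA _ (hρ.eta_mem h ha) _ (hρ.eta_mem h hb),
      ← map_sub, ρ.eta_gamma_comm]
  have hγ : ∀ h, ∀ x ∈ jointSpace P Q 0 1 ⊔ jointSpace P Q 1 0,
      ρ.gamma h (U x) = -U (ρ.gamma h x) := by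
    intro h x hx
    obtain ⟨a, ha, b, hb, rfl⟩ := Submodule.mem_sup.mp hx
    rw [hU, hU, hA a ha b hb, map_add (ρ.gamma h), add_comm (ρ.gamma h a),
      hA _ (hρ.gamma_mem h hb) _ (hρ.gamma_mem h ha), ← map_sub, ← map_neg, ← map_neg, neg_sub]
  refine ρ.balanced_restrict _ _ U (fun x hx => ?_) (fun x hx => ?_)
    (fun x hx => ?_) hη
    (fun h x hx => ρ.tau_anticomm h1 h h3 (hη _ _ (hL.2.1 h x hx)) (hγ h3 x hx)) hγ <;>
    obtain ⟨a, ha, b, hb, rfl⟩ := Submodule.mem_sup.mp hx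
  · rw [hU, hA a ha b hb, sub_eq_add_neg]
    exact hL.2.2 h3 _ (Submodule.add_mem_sup ha (Submodule.neg_mem _ hb))
  · rw [hU, hU, hA a ha b hb, sub_eq_add_neg, map_add, add_comm (ρ.gamma h3 a),
      hA _ (hρ.gamma_mem h3 (Submodule.neg_mem _ hb)) _ (hρ.gamma_mem h3 ha), map_sub, hgg, hgg]
    abel
  · rw [hU, LinearIsometryEquiv.norm_map, hA a ha b hb, hAn a ha b hb]

/-- All symmetries present, and a suitable complex structure on `H_01` exists. -/
theorem balanced_of_complexStructure (hρ : ρ.ActsOnPair P Q) (hP : star P = P) (hQ : star Q = Q)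
    [FiniteDimensional ℂ (jointSpace P Q 0 1)] (h1 : S.HasEta) (h3 : S.HasGamma)
    (hsq : (S.etaSq.get h1 = 1 ∧ Even (Module.finrank ℂ (jointSpace P Q 0 1))) ∨
      S.etaSq.get h1 = -1) : (ρ.restrict _ hρ.invariant_offDiag).Balanced := by
  obtain ⟨B, hB1, hB2, hB3, hB4⟩ := exists_skew_complexStructure
    (η := ((ρ.eta h1).toLinearEquiv : H →ₗ⋆[ℂ] H)) (inner_map_map_of_antiunitary (ρ.eta h1)) _
    (jointSpace P Q 0 1) rfl (fun x hx => hρ.eta_mem h1 hx) (by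
      rcases hsq with ⟨h, he⟩ | h
      · exact Or.inl ⟨fun x => (ρ.eta_sq h1 x).trans (by rw [h, one_smul]), he⟩
      · exact Or.inr fun x => (ρ.eta_sq h1 x).trans (by rw [h, neg_one_smul]))
  have hBη : ∀ x, ρ.eta h1 (B x) = B (ρ.eta h1 x) := fun x => (hB4 x).symm
  have hc := S.gammaSq_mul_self h3
  set c := S.gammaSq.get h3 with hcdef
  set γ := ρ.gamma h3 with hγdef
  have hγγ : ∀ x, γ (γ x) = c • x := ρ.gamma_sq h3
  have hsymm : ∀ x, γ.symm x = c • γ x := by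
    intro x
    rw [LinearIsometryEquiv.symm_apply_eq, map_zsmul, hγγ, smul_smul, hc, one_smul]
  have hB10 : ∀ b ∈ jointSpace P Q 1 0, B b = 0 := by
    intro b hb
    rw [← inner_self_eq_zero (𝕜 := ℂ), hB1,
      inner_jointSpace_eq_zero hP hQ (by simp) hb (hB2 _), neg_zero]
  have hγs : ∀ {i j : Fin 2} {x : H}, x ∈ jointSpace P Q i j → γ.symm x ∈ jointSpace P Q j i := by
    intro i j x hx
    rw [hsymm]
    exact Submodule.smul_of_tower_mem _ c (hρ.gamma_mem h3 hx)
  -- `B` is skew with range in `H_01`, so it vanishes on `H_10`. Transporting it there by `γ` with a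
  -- minus sign gives `γ U γ⁻¹ = -U`, since `γ²` is a scalar.
  let U : H →ₗ[ℂ] H :=
    B - γ.toLinearEquiv.toLinearMap ∘ₗ B ∘ₗ γ.symm.toLinearEquiv.toLinearMap
  have hU : ∀ x, U x = B x - γ (B (γ.symm x)) := fun x => rfl
  have hU01 : ∀ a ∈ jointSpace P Q 0 1, U a = B a := by
    intro a ha
    rw [hU, hB10 _ (hγs ha), map_zero, sub_zero]
  have hU10 : ∀ b ∈ jointSpace P Q 1 0, U b = -γ (B (γ.symm b)) := by
    intro b hb
    rw [hU, hB10 b hb, zero_sub]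
  have hUU : ∀ x ∈ jointSpace P Q 0 1 ⊔ jointSpace P Q 1 0, U (U x) = -x := by
    intro x hx
    obtain ⟨a, ha, b, hb, rfl⟩ := Submodule.mem_sup.mp hx
    rw [map_add, map_add, hU01 a ha, hU01 _ (hB2 a), hB3 a ha, hU10 b hb, map_neg,
      hU10 _ (hρ.gamma_mem h3 (hB2 _)), LinearIsometryEquiv.symm_apply_apply, hB3 _ (hγs hb),
      map_neg, LinearIsometryEquiv.apply_symm_apply]
    abel
  have hskew : ∀ x y, ⟪U x, y⟫_ℂ = -⟪x, U y⟫_ℂ := by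
    intro x y
    have h : ⟪γ (B (γ.symm x)), y⟫_ℂ = -⟪x, γ (B (γ.symm y))⟫_ℂ := by
      rw [← γ.symm.inner_map_map, ← γ.symm.inner_map_map x, LinearIsometryEquiv.symm_apply_apply,
        LinearIsometryEquiv.symm_apply_apply, hB1]
    rw [hU, hU, inner_sub_left, inner_sub_right, hB1, h]
    ring
  have hη : ∀ x, ρ.eta h1 (U x) = U (ρ.eta h1 x) := by
    intro x
    have hγη : ∀ x, ρ.eta h1 (γ x) = γ (ρ.eta h1 x) := ρ.eta_gamma_comm h1 h3
    rw [hU, hU, map_sub, hBη, hγη, hBη, hsymm, hsymm, map_zsmul, hγη]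
  have hγ : ∀ x, γ (U x) = -U (γ x) := by
    intro x
    rw [hU, hU, map_sub, hγγ, LinearIsometryEquiv.symm_apply_apply, hsymm, map_zsmul, smul_smul, hc,
      one_smul, neg_sub]
  refine ρ.balanced_restrict _ _ U (fun x hx => ?_) hUU
    (fun x hx => norm_eq_of_skew hskew (hUU x hx)) (fun h x _ => hη x)
    (fun h x _ => ρ.tau_anticomm h1 h h3 (hη _) (hγ x)) (fun h x _ => hγ x)
  obtain ⟨a, ha, b, hb, rfl⟩ := Submodule.mem_sup.mp hx
  rw [map_add, hU01 a ha, hU10 b hb]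
  exact Submodule.add_mem_sup (hB2 a) (Submodule.neg_mem _ (hρ.gamma_mem h3 (hB2 _)))

/-- The representation on `H_01 ⊕ H_10` is balanced as soon as the `ℤ/2` valued dimension indices
of the types `D` and `DIII` vanish. -/
theorem balanced_offDiag (hρ : ρ.ActsOnPair P Q) (hP : star P = P) (hQ : star Q = Q)
    [FiniteDimensional ℂ (jointSpace P Q 0 1)] [FiniteDimensional ℂ (jointSpace P Q 1 0)]
    (hD : S = .D → Even (Module.finrank ℂ (jointSpace P Q 0 1)
      + Module.finrank ℂ (jointSpace P Q 1 0)))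
    (hDIII : S = .DIII → Even (Module.finrank ℂ (jointSpace P Q 0 1))) :
    (ρ.restrict _ hρ.invariant_offDiag).Balanced := by
  have hdim : Module.finrank ℂ (jointSpace P Q 0 1 ⊔ jointSpace P Q 1 0 : Submodule ℂ H)
      = Module.finrank ℂ (jointSpace P Q 0 1) + Module.finrank ℂ (jointSpace P Q 1 0) := by
    have h := Submodule.finrank_sup_add_finrank_inf_eq (jointSpace P Q 0 1) (jointSpace P Q 1 0)
    have h0 : jointSpace P Q 0 1 ⊓ jointSpace P Q 1 0 = ⊥ := by
      rw [Submodule.eq_bot_iff]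
      rintro x ⟨h1, h2⟩
      exact inner_self_eq_zero.mp (inner_jointSpace_eq_zero hP hQ (by simp) h1 h2)
    rwa [h0, finrank_bot, add_zero] at h
  rw [← hdim] at hD
  cases S
  case A => exact ρ.balanced_of_not_eta_gamma _ _ Bool.false_ne_true Bool.false_ne_true
  case AI => exact ρ.balanced_of_not_eta_gamma _ _ Bool.false_ne_true Bool.false_ne_true
  case AII => exact ρ.balanced_of_not_eta_gamma _ _ Bool.false_ne_true Bool.false_ne_true
  case AIII => exact hρ.balanced_of_not_eta_tau hP hQ Bool.false_ne_true Bool.false_ne_true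
  case D =>
    exact ρ.balanced_of_not_tau_gamma _ _ rfl Bool.false_ne_true Bool.false_ne_true
      (Or.inl ⟨rfl, hD rfl⟩)
  case C =>
    exact ρ.balanced_of_not_tau_gamma _ _ rfl Bool.false_ne_true Bool.false_ne_true (Or.inr rfl)
  case BDI => exact hρ.balanced_of_gammaSq_eq_one hP hQ rfl rfl rfl
  case CII => exact hρ.balanced_of_gammaSq_eq_one hP hQ rfl rfl rfl
  case CI => exact hρ.balanced_of_complexStructure hP hQ rfl rfl (Or.inr rfl)
  case DIII => exact hρ.balanced_of_complexStructure hP hQ rfl rfl (Or.inl ⟨rfl, hDIII rfl⟩)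

end SymRep.ActsOnPair

end Balanced

/-! ### Half-space projections and local symmetries. -/

section HalfSpace

variable {H : Type*} [NormedAddCommGroup H] [InnerProductSpace ℂ H]

/-- The half space `⨁_{x ≥ a} H_x`. -/
noncomputable def halfSpace (cell : ℤ → Submodule ℂ H) (a : ℤ) : Submodule ℂ H :=
  (⨆ x : ℤ, ⨆ _ : a ≤ x, cell x).topologicalClosure

theorem cell_le_halfSpace (cell : ℤ → Submodule ℂ H) {a x : ℤ} (h : a ≤ x) :
    cell x ≤ halfSpace cell a :=
  (le_iSup₂ (f := fun (y : ℤ) (_ : a ≤ y) => cell y) x h).trans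
    (Submodule.le_topologicalClosure _)

theorem halfSpace_le {cell : ℤ → Submodule ℂ H} {a : ℤ} {N : Submodule ℂ H}
    (hN : IsClosed (N : Set H)) (h : ∀ x, a ≤ x → cell x ≤ N) : halfSpace cell a ≤ N :=
  Submodule.topologicalClosure_minimal _ (iSup₂_le h) hN

theorem mem_halfSpace_orthogonal {cell : ℤ → Submodule ℂ H} {a : ℤ} {v : H}
    (h : ∀ x, a ≤ x → v ∈ (cell x)ᗮ) : v ∈ (halfSpace cell a)ᗮ := by
  have hle : halfSpace cell a ≤ (Submodule.span ℂ {v})ᗮ :=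
    halfSpace_le (Submodule.isClosed_orthogonal _) fun x hx y hy =>
      Submodule.mem_orthogonal_singleton_iff_inner_left.mpr (h x hx y hy)
  exact fun y hy => Submodule.mem_orthogonal_singleton_iff_inner_left.mp (hle hy)

/-- Since `e² = ±1`, invariance improves to `e N = N`, so `e` preserves the orthogonal complement as
well. -/
theorem map_starProjection_of_sq {σ : ℂ →+* ℂ} [RingHomInvPair σ σ] (e : H ≃ₛₗᵢ[σ] H)
    (he : PreservesInner e) (c : ℤ) (hc : c * c = 1) (hee : ∀ x, e (e x) = c • x)
    (N : Submodule ℂ H) [N.HasOrthogonalProjection] (hN : ∀ x ∈ N, e x ∈ N) (x : H) :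
    e (N.starProjection x) = N.starProjection (e x) := by
  symm
  apply Submodule.eq_starProjection_of_mem_orthogonal
  · exact hN _ (Submodule.starProjection_apply_mem _ _)
  · rw [← map_sub]
    have h := map_mem_orthogonal he (Submodule.sub_starProjection_mem_orthogonal (K := N) x)
    rwa [map_eq_of_sq e N hN c hc hee] at h

variable [CompleteSpace H]

instance completeSpace_halfSpace (cell : ℤ → Submodule ℂ H) (a : ℤ) : CompleteSpace (halfSpace cell a) :=
  (Submodule.isClosed_topologicalClosure _).completeSpace_coe

theorem halfProj_eq (cell : ℤ → Submodule ℂ H) (a : ℤ) :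
    halfProj cell a = (halfSpace cell a).starProjection := rfl

theorem IsCellStructure.halfProj_eq_add {cell : ℤ → Submodule ℂ H} (hcell : IsCellStructure cell)
    (a : ℤ) [FiniteDimensional ℂ (cell a)] :
    halfProj cell a = (cell a).starProjection + halfProj cell (a + 1) := by
  ext v
  rw [halfProj_eq, halfProj_eq, add_apply]
  have horth : ∀ w ∈ halfSpace cell (a + 1), w ∈ (cell a)ᗮ := by
    have hle : halfSpace cell (a + 1) ≤ (cell a)ᗮ :=
      halfSpace_le (Submodule.isClosed_orthogonal _) fun x hx y hy z hz =>
        hcell.orthogonal a x (by omega) z hz y hy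
    exact fun w hw => hle hw
  apply Submodule.eq_starProjection_of_mem_orthogonal
  · refine Submodule.add_mem _ (cell_le_halfSpace cell le_rfl
      (Submodule.starProjection_apply_mem _ _)) ?_
    exact halfSpace_le (Submodule.isClosed_topologicalClosure _)
      (fun x hx => cell_le_halfSpace cell (by omega)) (Submodule.starProjection_apply_mem _ _)
  · apply mem_halfSpace_orthogonal
    intro x hx
    rcases eq_or_lt_of_le hx with rfl | hlt
    · rw [← sub_sub]
      exact Submodule.sub_mem _ (Submodule.sub_starProjection_mem_orthogonal _)
        (horth _ (Submodule.starProjection_apply_mem _ _))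
    · rw [add_comm, ← sub_sub]
      refine Submodule.sub_mem _ ?_ ?_
      · exact Submodule.orthogonal_le (cell_le_halfSpace cell (a := a + 1) hlt)
          (Submodule.sub_starProjection_mem_orthogonal _)
      · exact fun y hy => hcell.orthogonal x a hlt.ne' y hy _
          (Submodule.starProjection_apply_mem _ _)

/-- Only finitely many cells lie between the cuts, and each contributes a finite-rank projection. -/
theorem IsCellStructure.isCompactOperator_halfProj_sub {cell : ℤ → Submodule ℂ H}
    (hcell : IsCellStructure cell) (a b : ℤ) :
    IsCompactOperator (halfProj cell a - halfProj cell b : H →L[ℂ] H) := by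
  have key : ∀ (n : ℕ) (a : ℤ),
      IsCompactOperator (halfProj cell a - halfProj cell (a + n) : H →L[ℂ] H) := by
    intro n
    induction n with
    | zero =>
      intro a
      rw [Nat.cast_zero, add_zero, sub_self]
      exact isCompactOperator_zero
    | succ n ih =>
      intro a
      have := hcell.finiteDimensional (a + n)
      have e : halfProj cell a - halfProj cell (a + (n + 1 : ℕ))
          = (halfProj cell a - halfProj cell (a + n)) + (cell (a + n)).starProjection := by
        rw [hcell.halfProj_eq_add (a + n), Nat.cast_succ, ← add_assoc]
        abel
      rw [e]
      exact (ih a).add (isCompactOperator_starProjection _)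
  rcases le_total a b with h | h
  · have := key (b - a).toNat a
    rwa [Int.toNat_of_nonneg (by omega), add_sub_cancel] at this
  · have := key (a - b).toNat b
    rw [Int.toNat_of_nonneg (by omega), add_sub_cancel] at this
    rw [← neg_sub]
    exact this.neg

/-- A symmetry that acts locally commutes with the half-space projections. -/
theorem map_halfProj {σ : ℂ →+* ℂ} [RingHomInvPair σ σ] (e : H ≃ₛₗᵢ[σ] H)
    (he : PreservesInner e) (c : ℤ) (hc : c * c = 1) (hee : ∀ x, e (e x) = c • x)
    {cell : ℤ → Submodule ℂ H} (hcell : ∀ x, ∀ φ ∈ cell x, e φ ∈ cell x) (a : ℤ) (x : H) :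
    e (halfProj cell a x) = halfProj cell a (e x) := by
  rw [halfProj_eq]
  apply map_starProjection_of_sq e he c hc hee
  have hle : halfSpace cell a ≤ (halfSpace cell a).comap (e.toLinearEquiv : H →ₛₗ[σ] H) :=
    halfSpace_le ((Submodule.isClosed_topologicalClosure _).preimage e.continuous)
      fun x hx φ hφ => cell_le_halfSpace cell hx (hcell x φ hφ)
  exact fun φ hφ => hle hφ

theorem star_unitaryOp (U : H ≃ₗᵢ[ℂ] H) : star (unitaryOp U) = unitaryOp U.symm := by
  rw [ContinuousLinearMap.star_eq_adjoint, eq_comm, ContinuousLinearMap.eq_adjoint_iff]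
  intro x y
  have := U.inner_map_map (U.symm x) y
  rw [U.apply_symm_apply] at this
  exact this.symm

end HalfSpace

/-! ### The dimensions of `H_01` and `H_10` as kernel dimensions. -/

section Index

variable {H : Type*} [NormedAddCommGroup H] [InnerProductSpace ℂ H]

/-- An antiunitary involution is a conjugation. -/
theorem isConjugation_of_sq (e : H ≃ₗᵢ⋆[ℂ] H) (he : ∀ x, e (e x) = x) :
    IsConjugation (e.toLinearEquiv : H →ₗ⋆[ℂ] H) where
  apply_apply := he
  inner_comm x y := by
    change ⟪e x, y⟫_ℂ = ⟪e y, x⟫_ℂ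
    conv_lhs => rw [← he y]
    exact inner_map_map_of_antiunitary e _ _

variable [CompleteSpace H] {W : H ≃ₗᵢ[ℂ] H} {P Q : H →L[ℂ] H}

/-- `W⁻¹` carries `H_01` onto the kernel: `Qy = y` says that `W⁻¹y` lies in the range of `P`, and
`Py = 0` says that `PW` kills it. -/
theorem finrank_jointSpace_zero_one (hPP : P * P = P)
    (hQ : Q = unitaryOp W * P * unitaryOp W.symm) :
    Module.finrank ℂ (jointSpace P Q 0 1)
      = Module.finrank ℂ (compressedPath (unitaryOp W) P 0).ker := by
  rw [← LinearEquiv.finrank_map_eq W.toLinearEquiv (compressedPath (unitaryOp W) P 0).ker]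
  suffices h : jointSpace P Q 0 1
      = (compressedPath (unitaryOp W) P 0).ker.map W.toLinearEquiv.toLinearMap by rw [h]
  ext y
  rw [Submodule.mem_map_equiv]
  refine Iff.trans ?_ (mem_ker_compressedPath hPP 0 _).symm
  rw [mem_jointSpace, hQ, Set.Icc.coe_zero, Complex.ofReal_zero, zero_smul]
  change P y = ((0 : ℕ) : ℂ) • y ∧ W (P (W.symm y)) = ((1 : ℕ) : ℂ) • y ↔
    P (W.symm y) = W.symm y ∧ P (W (W.symm y)) = 0
  rw [Nat.cast_zero, Nat.cast_one, zero_smul, one_smul, W.apply_symm_apply, and_comm,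
    W.eq_symm_apply]

theorem finrank_jointSpace_one_zero (hPP : P * P = P) (hP : star P = P)
    (hQ : Q = unitaryOp W * P * unitaryOp W.symm) :
    Module.finrank ℂ (jointSpace P Q 1 0)
      = Module.finrank ℂ (star (compressedPath (unitaryOp W) P 0)).ker := by
  suffices h : jointSpace P Q 1 0 = (star (compressedPath (unitaryOp W) P 0)).ker by rw [h]
  ext y
  refine Iff.trans ?_ (mem_ker_star_compressedPath hPP hP 0 _).symm
  rw [mem_jointSpace, hQ, Set.Icc.coe_zero, Complex.ofReal_zero, zero_smul, star_unitaryOp]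
  change P y = ((1 : ℕ) : ℂ) • y ∧ W (P (W.symm y)) = ((0 : ℕ) : ℂ) • y ↔
    P y = y ∧ P (W.symm y) = 0
  rw [Nat.cast_zero, Nat.cast_one, zero_smul, one_smul]
  exact and_congr_right' (LinearIsometryEquiv.map_eq_zero_iff W)

end Index

/-! ### Assembly of the proposition. -/

theorem mainTheorem10 {H : Type*} [NormedAddCommGroup H] [InnerProductSpace ℂ H] [CompleteSpace H]
    (cell : ℤ → Submodule ℂ H) (hcell : IsCellStructure cell)
    (S : SymType) (ρ : SymRep S H)
    (hloc : ∀ x, ρ.Invariant (cell x))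
    (hbal : ∀ x, (ρ.restrict (cell x) (hloc x)).Balanced)
    (W : H ≃ₗᵢ[ℂ] H) (hW : ρ.Admissible W) (hWloc : EssLocal cell W)
    (ρt : SymRep S H) (hρt : ρt = ρ.twist W hW.1)
    (P Q : H →L[ℂ] H) (hP : P = halfProj cell 0)
    (hQ : Q = unitaryOp W * P * unitaryOp W.symm) :
    (ρt.Invariant (jointSpace P Q 0 0) ∧ ρt.Invariant (jointSpace P Q 1 1) ∧
      ρt.Invariant (perpSpace P Q) ∧
      ρt.Invariant (jointSpace P Q 0 1 ⊔ jointSpace P Q 1 0)) ∧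
    (∀ i j : Fin 2, i ≠ j →
      (∀ h, (jointSpace P Q i j).map ((ρt.eta h).toLinearEquiv : H →ₗ⋆[ℂ] H)
        = jointSpace P Q i j) ∧
      (∀ h, (jointSpace P Q i j).map ((ρt.tau h).toLinearEquiv : H →ₗ⋆[ℂ] H)
        = jointSpace P Q j i) ∧
      (∀ h, (jointSpace P Q i j).map ((ρt.gamma h).toLinearEquiv : H →ₗ[ℂ] H)
        = jointSpace P Q j i)) ∧
    (∃ (hK : ρt.Invariant (jointSpace P Q 0 0 ⊔ jointSpace P Q 1 1 ⊔ perpSpace P Q))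
      (V : ↥(jointSpace P Q 0 0 ⊔ jointSpace P Q 1 1 ⊔ perpSpace P Q) ≃ₗᵢ[ℂ]
        ↥(jointSpace P Q 0 0 ⊔ jointSpace P Q 1 1 ⊔ perpSpace P Q)),
      (∀ φ, (V φ : H) = vCan P Q (φ : H)) ∧
      (ρt.restrict _ hK).Satisfies V ∧
      EssGapAt (unitaryOp V) (-1) ∧
      ¬ Module.End.HasEigenvalue (unitaryOp V).toLinearMap (-1)) ∧
    (∃ hK : ρt.Invariant (jointSpace P Q 0 1 ⊔ jointSpace P Q 1 0),
      (ρt.restrict _ hK).Balanced) := by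
  have hPs : star P = P := by
    rw [hP]
    exact isSelfAdjoint_starProjection _
  have hPP : P * P = P := by
    rw [hP]
    exact Submodule.isIdempotentElem_starProjection _
  have hww : star (unitaryOp W) * unitaryOp W = 1 := by
    rw [star_unitaryOp]
    ext x
    exact W.symm_apply_apply x
  have hww' : unitaryOp W * star (unitaryOp W) = 1 := by
    rw [star_unitaryOp]
    ext x
    exact W.apply_symm_apply x
  have hQ' : Q = unitaryOp W * P * star (unitaryOp W) := by rw [hQ, star_unitaryOp]
  have hQs : star Q = Q := by
    rw [hQ', star_mul, star_mul, star_star, hPs, mul_assoc]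
  have hQQ : Q * Q = Q := by
    rw [hQ', mul_assoc, ← mul_assoc (star (unitaryOp W)), ← mul_assoc (star (unitaryOp W)), hww,
      one_mul, ← mul_assoc, mul_assoc (unitaryOp W), hPP]
  have hc : IsCompactOperator (P - Q : H →L[ℂ] H) := by
    obtain ⟨a, ha⟩ := hWloc
    rw [← star_unitaryOp] at ha
    have hd := hcell.isCompactOperator_halfProj_sub 0 a
    rw [← hP] at hd
    set Pa := halfProj cell a
    -- Locality is given at the cut `a`, and for `W*` rather than `W`; conjugating by `W` and moving
    -- the cut to `0` reduces `P - Q` to compact terms.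
    have e : P - Q = (P - Pa) - unitaryOp W * ((P - Pa) * star (unitaryOp W))
        - unitaryOp W * ((Pa - star (unitaryOp W) * Pa * unitaryOp W) * star (unitaryOp W)) := by
      have e1 : unitaryOp W * ((Pa - star (unitaryOp W) * Pa * unitaryOp W) * star (unitaryOp W))
          = unitaryOp W * Pa * star (unitaryOp W) - Pa := by
        rw [sub_mul, mul_sub, mul_assoc _ (unitaryOp W), hww', mul_one, ← mul_assoc (unitaryOp W),
          ← mul_assoc (unitaryOp W) (star (unitaryOp W)), hww', one_mul, mul_assoc]
      rw [e1, hQ', sub_mul, mul_sub, ← mul_assoc, ← mul_assoc]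
      abel
    rw [e]
    exact (hd.sub ((hd.comp_clm (star (unitaryOp W))).clm_comp (unitaryOp W))).sub
      ((ha.comp_clm (star (unitaryOp W))).clm_comp (unitaryOp W))
  have hηP : ∀ h x, ρ.eta h (P x) = P (ρ.eta h x) := fun h x => by
    rw [hP]
    exact map_halfProj _ (preservesInner_of_antiunitary _) _ (S.etaSq_mul_self h) (ρ.eta_sq h)
      (fun y => (hloc y).1 h) 0 x
  have hτP : ∀ h x, ρ.tau h (P x) = P (ρ.tau h x) := fun h x => by
    rw [hP]
    exact map_halfProj _ (preservesInner_of_antiunitary _) _ (S.tauSq_mul_self h) (ρ.tau_sq h)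
      (fun y => (hloc y).2.1 h) 0 x
  have hγP : ∀ h x, ρ.gamma h (P x) = P (ρ.gamma h x) := fun h x => by
    rw [hP]
    exact map_halfProj _ (preservesInner_of_unitary _) _ (S.gammaSq_mul_self h) (ρ.gamma_sq h)
      (fun y => (hloc y).2.2 h) 0 x
  have hQa : ∀ x, Q x = W (P (W.symm x)) := fun x => by
    rw [hQ]
    rfl
  have hWη : ∀ h x, ρ.eta h (W x) = W (ρ.eta h x) := hW.1.eta_comm
  have hWη' : ∀ h x, ρ.eta h (W.symm x) = W.symm (ρ.eta h x) := fun h x => by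
    rw [W.eq_symm_apply, ← hWη, W.apply_symm_apply]
  have hWτ : ∀ h x, W (ρ.tau h x) = ρ.tau h (W.symm x) := fun h x => by
    have := hW.1.tau_comm h (W.symm x)
    rwa [W.apply_symm_apply] at this
  have hWγ : ∀ h x, W (ρ.gamma h x) = ρ.gamma h (W.symm x) := fun h x => by
    have := hW.1.gamma_comm h (W.symm x)
    rwa [W.apply_symm_apply] at this
  -- `WτP = QWτ` holds because `τ` commutes with `P`; the reverse exchange uses `Wτ = τW*`, and
  -- likewise for `γ`.
  have hpair : ρt.ActsOnPair P Q := by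
    subst hρt
    refine ⟨hηP, fun h x => ?_, fun h x => ?_, fun h x => ?_, fun h x => ?_, fun h x => ?_⟩
    · change ρ.eta h (Q x) = Q (ρ.eta h x)
      rw [hQa, hQa, hWη, hηP, hWη']
    · change W (ρ.tau h (P x)) = Q (W (ρ.tau h x))
      rw [hQa, W.symm_apply_apply, hτP]
    · change W (ρ.tau h (Q x)) = P (W (ρ.tau h x))
      rw [hWτ, hWτ, hQa, W.symm_apply_apply, hτP]
    · change W (ρ.gamma h (P x)) = Q (W (ρ.gamma h x))
      rw [hQa, W.symm_apply_apply, hγP]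
    · change W (ρ.gamma h (Q x)) = P (W (ρ.gamma h x))
      rw [hWγ, hWγ, hQa, W.symm_apply_apply, hγP]
  have hker := ker_opX hPP hQQ
  have hfd : FiniteDimensional ℂ (opX P Q).ker := by
    -- `X*` is a left parametrix of `X`, because `X*X - 1 = -(P - Q)²` is compact.
    apply finiteDimensional_ker_of_leftParametrix (R := star (opX P Q))
    rw [star_opX_mul_opX hPs hQs hPP hQQ, sub_sub_cancel_left]
    exact (hc.comp_clm (P - Q)).neg
  have hfd01 : FiniteDimensional ℂ (jointSpace P Q 0 1) :=
    Submodule.finiteDimensional_of_le (le_sup_left.trans hker.ge)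
  have hfd10 : FiniteDimensional ℂ (jointSpace P Q 1 0) :=
    Submodule.finiteDimensional_of_le (le_sup_right.trans hker.ge)
  have hconj : ∀ h : S.HasEta, S.etaSq.get h = 1 →
      IsConjugation ((ρ.eta h).toLinearEquiv : H →ₗ⋆[ℂ] H) := fun h hsq =>
    isConjugation_of_sq _ fun x => by rw [ρ.eta_sq, hsq, one_smul]
  have hstarη : ∀ h x, star (unitaryOp W) (ρ.eta h x) = ρ.eta h (star (unitaryOp W) x) := by
    rw [star_unitaryOp]
    exact fun h x => (hWη' h x).symm
  have hpw : IsCompactOperator (P - unitaryOp W * P * star (unitaryOp W) : H →L[ℂ] H) := by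
    rwa [← hQ']
  refine ⟨⟨hpair.invariant_diag 0, hpair.invariant_diag 1, hpair.invariant_perpSpace,
    hpair.invariant_offDiag⟩, fun i j _ => ⟨fun h => hpair.map_eta h i j,
    fun h => hpair.map_tau h i j, fun h => hpair.map_gamma h i j⟩,
    ⟨hpair.invariant_decoupled, exists_decoupling hpair hPs hQs hPP hQQ hc _ _ ?_⟩,
    ⟨hpair.invariant_offDiag, hpair.balanced_offDiag hPs hQs ?_ ?_⟩⟩
  · rw [hker, jointSpace_sup_perpSpace hPs hQs]
  · rintro rfl
    rw [finrank_jointSpace_zero_one hPP hQ, finrank_jointSpace_one_zero hPP hPs hQ]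
    have h : SymType.D.HasEta := rfl
    exact even_finrank_ker_compressedPath_add (hconj h rfl) hww hww' hPP hPs
      (fun x => (hWη h x).symm) (hstarη h) (fun x => (hηP h x).symm) hpw hW.2.1 hW.2.2
  · rintro rfl
    rw [finrank_jointSpace_zero_one hPP hQ]
    have h : SymType.DIII.HasEta := rfl
    have h3 : SymType.DIII.HasGamma := rfl
    have hγγ : ∀ x, ρ.gamma h3 (ρ.gamma h3 x) = -x := fun x =>
      (ρ.gamma_sq h3 x).trans (neg_one_smul ℤ x)
    refine even_finrank_ker_compressedPath_of_chiral (hconj h rfl) (g := unitaryOp (ρ.gamma h3))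
      ?_ ?_ ?_ ?_ hww hww' hPP hPs (fun x => (ρ.eta_gamma_comm h h3 x).symm)
      (fun x => (hWη h x).symm) (hstarη h) (fun x => (hηP h x).symm) hpw hW.2.1 hW.2.2
    · rw [star_unitaryOp]
      ext x
      change (ρ.gamma h3).symm x = -ρ.gamma h3 x
      rw [LinearIsometryEquiv.symm_apply_eq, map_neg, hγγ, neg_neg]
    · ext x
      exact hγγ x
    · ext x
      exact hγP h3 x
    · rw [star_unitaryOp]
      ext x
      change ρ.gamma h3 (W x) = W.symm (ρ.gamma h3 x)
      rw [W.eq_symm_apply, hWγ, W.symm_apply_apply]
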